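/- Let $\mathbb{K}$ be a field, $V=\mathbb{K}^\ell$ and $S=\mathrm{Sym}^*(V^*)=\mathbb{K}[x_1,\dots,x_\ell]$. An arrangement $\mathcal{A}$ in $V$ is a finite set of linear hyperplanes $L=\ker\alpha_L$, $0\neq\alpha_L\in V^*$, and $$D(\mathcal{A})=\{\theta\in\mathrm{Der}_{\mathbb{K}}(S)\mid \theta(\alpha_L)\in S\alpha_L\ \text{for all } L\in\mathcal{A}\},$$ graded by polynomial degree (a nonzero $\theta$ is homogeneous of degree $m$ if $\theta(\alpha)\in S_m$ for all $\alpha\in V^*$). $\mathcal{A}$ is *free* with exponents the multiset $\exp(\mathcal{A})=(e_1,\dots,e_\ell)$ if $D(\mathcal{A})\simeq\bigoplus_{k=1}^{\ell} S[-e_k]$ as graded modules. $\mathcal{A}$ is *SPOG* with $\mathrm{POexp}(\mathcal{A})=(e_1,\dots,e_\ell)$ (a multiset containing $1$) and *level* $d$ if $D(\mathcal{A})$ has a minimal graded free resolution $$0\to S[-d-1]\to\bigoplus_{k=1}^{\ell}S[-e_k]\oplus S[-d]\to D(\mathcal{A})\to 0 .$$ **Theorem 1.5.** Let $\mathcal{A}$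 be an arrangement in $V=\mathbb{K}^\ell$, let $H\in\mathcal{A}$, $\mathcal{A}'=\mathcal{A}\setminus\{H\}$, and let $\mathcal{A}^H=\{H\cap L\mid L\in\mathcal{A}'\}$, an arrangement in $H$. Assume that $\mathcal{A}'$ is free with exponents $(d_1,d_2,\dots,d_\ell)$, where $1=d_1\le d_2\le\dots\le d_\ell$. Let $2\le i<j\le\ell$, put $d:=d_i+d_j+|\mathcal{A}^H|-|\mathcal{A}'|$, and suppose that $d_j<d$ and, if $j<\ell$, that $d\le d_{j+1}$. Then the following two conditions are equivalent: 1. $\mathcal{A}^H$ is free with exponents the multiset obtained from $(1,d_2,\dots,d_\ell)$ by removing $d_i$ and $d_j$ (one occurrence for each of the two indices) and adding $d$. 2. $\mathcal{A}$ is SPOG with level $d$ and with $\mathrm{POexp}(\mathcal{A})$ the multiset obtained from $(1,d_2,\dots,d_\ell)$ by replacing $d_i$ by $d_i+1$ and $d_j$ by $d_j+1$. -/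

import Mathlib

namespace Arr

/-- The coordinate ring `S = Sym(V*)` of a `K`-vector space `V`. -/
def CoordRing (K V : Type*) [Field K] [AddCommGroup V] [Module K V] : Type _ :=
  SymmetricAlgebra K (Module.Dual K V)

noncomputable instance (K V : Type*) [Field K] [AddCommGroup V] [Module K V] :
    CommRing (CoordRing K V) :=
  inferInstanceAs (CommRing (SymmetricAlgebra K (Module.Dual K V)))

noncomputable instance (K V : Type*) [Field K] [AddCommGroup V] [Module K V] :
    Algebra K (CoordRing K V) :=
  inferInstanceAs (Algebra K (SymmetricAlgebra K (Module.Dual K V)))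

/-- The module `Der S` of `K`-linear derivations of the coordinate ring. -/
abbrev Der (K V : Type*) [Field K] [AddCommGroup V] [Module K V] : Type _ :=
  Derivation K (CoordRing K V) (CoordRing K V)

section

variable {K V : Type*} [Field K] [AddCommGroup V] [Module K V]

/-- The canonical inclusion `V* → S`: a linear form on `V`, seen as an element of the
coordinate ring. -/
noncomputable def form : Module.Dual K V →ₗ[K] CoordRing K V :=
  SymmetricAlgebra.ι K (Module.Dual K V)

/-- The homogeneous polynomials of degree `m`: the `K`-span of the products of `m` linear forms. -/
noncomputable def homogPart (K V : Type*) [Field K] [AddCommGroup V] [Module K V] (m : ℕ) :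
    Submodule K (CoordRing K V) :=
  LinearMap.range (form : Module.Dual K V →ₗ[K] CoordRing K V) ^ m

/-- The degree `m` part of the shifted free module `S[-e]`, that is `S_{m - e}`,
which is zero for `m < e`. -/
noncomputable def shiftedPart (K V : Type*) [Field K] [AddCommGroup V] [Module K V] (e m : ℕ) :
    Submodule K (CoordRing K V) :=
  if e ≤ m then homogPart K V (m - e) else ⊥

/-- The ideal of `S` generated by all linear forms (the homogeneous maximal ideal). -/
noncomputable def irrelevantIdeal (K V : Type*) [Field K] [AddCommGroup V] [Module K V] :
    Ideal (CoordRing K V) :=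
  Ideal.span (Set.range (form : Module.Dual K V →ₗ[K] CoordRing K V))

/-- A derivation is homogeneous of (polynomial) degree `m` if it sends all linear forms to
homogeneous polynomials of degree `m`. In particular the Euler derivation has degree `1`. -/
def IsHomogDer (m : ℕ) (θ : Der K V) : Prop :=
  ∀ a : Module.Dual K V, θ (form a) ∈ homogPart K V m

/-- A (linear) hyperplane: the zero locus of a nonzero linear form. -/
def IsHyperplane (H : Submodule K V) : Prop :=
  ∃ a : Module.Dual K V, a ≠ 0 ∧ H = LinearMap.ker a

/-- A (central) hyperplane arrangement: a finite set of hyperplanes. -/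
def IsArrangement (A : Finset (Submodule K V)) : Prop :=
  ∀ L ∈ A, IsHyperplane L

/-- The logarithmic derivation module `D(A)`. For each `L ∈ A` all linear forms with zero
locus `L` are considered; they differ by nonzero scalars. -/
noncomputable def logDer (A : Finset (Submodule K V)) : Submodule (CoordRing K V) (Der K V) where
  carrier := {θ | ∀ L ∈ A, ∀ a : Module.Dual K V, L = LinearMap.ker a →
    θ (form a) ∈ Ideal.span {form a}}
  add_mem' := fun hx hy L hL a ha => by
    simpa using Ideal.add_mem _ (hx L hL a ha) (hy L hL a ha)
  zero_mem' := fun L hL a ha => by simp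
  smul_mem' := fun c x hx L hL a ha => by
    simpa using Ideal.mul_mem_left _ c (hx L hL a ha)

open Classical in
/-- The deletion `A ∖ {H}`. -/
noncomputable def deletion (A : Finset (Submodule K V)) (H : Submodule K V) :
    Finset (Submodule K V) :=
  A.erase H

open Classical in
/-- The restriction `A^H = {H ∩ L | L ∈ A ∖ {H}}`, an arrangement in the vector space `H`. -/
noncomputable def restriction (A : Finset (Submodule K V)) (H : Submodule K V) :
    Finset (Submodule K H) :=
  (deletion A H).image (fun L => Submodule.comap H.subtype L)

/-- `A` is free with multiset of exponents `E`: the module `D(A)` is isomorphic to the graded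
module `⨁ S[-e]` (`e ∈ E`), that is, it has an `S`-basis of homogeneous derivations whose
degrees form `E`. -/
def IsFreeWithExp (A : Finset (Submodule K V)) (E : Multiset ℕ) : Prop :=
  ∃ (e : Fin (Module.finrank K V) → ℕ)
    (b : Module.Basis (Fin (Module.finrank K V)) (CoordRing K V) (logDer A)),
    Finset.univ.val.map e = E ∧ ∀ k, IsHomogDer (e k) (b k : Der K V)

/-- The graded submodule `M` of `Der S` has a minimal graded free resolution
`0 → ⨁ₖ S[-(q k)] → ⨁ᵢ S[-(p i)] → M → 0`.
The right map sends the basis vectors to homogeneous elements `g i` of degree `p i`, which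
generate `M`. The left map is given by a matrix `r` with entries of the right degrees; it is
injective (the rows of `r` are linearly independent), its image is the kernel of the right map,
and minimality means that all its entries lie in the homogeneous maximal ideal. -/
def HasMinFreeRes {I J : Type*} [Fintype I] (M : Submodule (CoordRing K V) (Der K V))
    (p : I → ℕ) (q : J → ℕ) : Prop :=
  ∃ (g : I → Der K V) (r : J → I → CoordRing K V),
    (∀ i, IsHomogDer (p i) (g i)) ∧
    (∀ k i, r k i ∈ shiftedPart K V (p i) (q k)) ∧
    (∀ k i, r k i ∈ irrelevantIdeal K V) ∧
    Submodule.span (CoordRing K V) (Set.range g) = M ∧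
    LinearIndependent (CoordRing K V) r ∧
    (∀ c : I → CoordRing K V,
      ∑ i, c i • g i = 0 ↔ c ∈ Submodule.span (CoordRing K V) (Set.range r))

/-- `A` is SPOG with `POexp(A) = E` and level `d`: there is a minimal free resolution
`0 → S[-d-1] → ⨁ S[-e] ⊕ S[-d] → D(A) → 0`, where `e` runs through the `ℓ = dim V` members
of the multiset `E`, one of which is `1`. -/
def IsSPOG (A : Finset (Submodule K V)) (E : Multiset ℕ) (d : ℕ) : Prop :=
  1 ∈ E ∧ ∃ e : Fin (Module.finrank K V) → ℕ,
    Finset.univ.val.map e = E ∧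
    HasMinFreeRes (logDer A)
      (Sum.elim e (fun _ : Unit => d)) (fun _ : Unit => d + 1)

end

end Arr

/-!
Let `θ k` be a homogeneous basis of `D(A ∖ {H})`, of degrees `e k`, let `α` be a linear form with
kernel `H`, let `S` and `S'` be the coordinate rings of `V` and of `H`, and let `f k ∈ S'` be the
restriction of `θ k (α)` to `H`. A combination `∑ c k • θ k` lies in `D(A)` if and only if the
restrictions of the `c k` to `H` are a syzygy of the `f k`. So `D(A) / α D(A ∖ {H})` is the module
`N` of syzygies of the `f k`. Restricting derivations to `H` embeds `N` into `D(A^H)`, and this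
embedding is onto (`resCombo_injective`, `exists_der_of_syzygy`, `exists_resCombo_eq`). Surjectivity
holds because denominators can be removed one hyperplane of `A^H` at a time, `S'` being a unique
factorization domain.

Each of the two conditions of the theorem determines the Hilbert function of `N`, and both give the
same one: that of the free `S'`-module with generators of degree `D` and of degrees `e k`, where two
of the latter, of degrees `p = d i` and `q = d j`, are left out. For the freeness of `A^H` this is
immediate (`finrank_syzPart_of_free`). For the resolution of `D(A)` it follows from
`D(A) / α D(A ∖ {H}) = N` by counting dimensions in each degree (`finrank_syzPart_add`,
`finrank_map_combo_of_res`, `hilb_eq_add`).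

Conversely, this Hilbert function forces both conditions. It gives the Hilbert function of the ideal
`I` generated by the `f k`. As no `e k` lies strictly between `q` and `D`, comparing `I` degree by
degree with the ideal of two well-chosen generators, of degrees `p` and `q`, shows that these two
generate `I` and that their syzygies are generated by one of degree `D`
(`exists_two_generators`). Then `N` has an explicit basis, which is a basis of `D(A^H)`
(`exists_basis_restriction`), and lifting it to `S` yields the generators of `D(A)` and their only
relation (`hasMinFreeRes_of_generators`).
-/

namespace Arr
open Polynomial

/-! ### The coordinate ring -/

section CoordRing

variable {K V : Type*} [Field K] [AddCommGroup V] [Module K V]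

/-- The universal property of the coordinate ring: algebra homomorphisms out of it are determined
by arbitrary linear images of the linear forms. -/
noncomputable def liftForm {B : Type*} [CommRing B] [Algebra K B] (f : Module.Dual K V →ₗ[K] B) :
    CoordRing K V →ₐ[K] B :=
  SymmetricAlgebra.lift f

@[simp]
theorem liftForm_form {B : Type*} [CommRing B] [Algebra K B] (f : Module.Dual K V →ₗ[K] B)
    (a : Module.Dual K V) : liftForm f (form a) = f a :=
  SymmetricAlgebra.lift_ι_apply f a

theorem coordRing_algHom_ext {B : Type*} [CommRing B] [Algebra K B] {F G : CoordRing K V →ₐ[K] B}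
    (h : ∀ a, F (form a) = G (form a)) : F = G :=
  SymmetricAlgebra.algHom_ext (LinearMap.ext h)

theorem coordRing_induction {P : CoordRing K V → Prop}
    (hK : ∀ r : K, P (algebraMap K _ r)) (hform : ∀ a, P (form a))
    (hmul : ∀ x y, P x → P y → P (x * y)) (hadd : ∀ x y, P x → P y → P (x + y))
    (x : CoordRing K V) : P x :=
  @SymmetricAlgebra.induction K (Module.Dual K V) _ _ _ P hK hform hmul hadd x

instance : IsDomain (CoordRing K V) :=
  inferInstanceAs (IsDomain (SymmetricAlgebra K (Module.Dual K V)))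

instance [FiniteDimensional K V] : UniqueFactorizationMonoid (CoordRing K V) :=
  (SymmetricAlgebra.equivMvPolynomial
    (Module.finBasis K (Module.Dual K V))).symm.toMulEquiv.uniqueFactorizationMonoid inferInstance

/-- The linear forms embed into the coordinate ring: the square-zero extension `K ⊕ V*`
separates them. -/
theorem form_injective : Function.Injective (form : Module.Dual K V →ₗ[K] CoordRing K V) := by
  intro a b h
  have := congrArg (liftForm (TrivSqZeroExt.inrHom K (Module.Dual K V))) h
  rw [liftForm_form, liftForm_form] at this
  exact TrivSqZeroExt.inr_injective this

/-! ### The grading of the coordinate ring -/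

theorem homogPart_mul {m n : ℕ} {x y : CoordRing K V} (hx : x ∈ homogPart K V m)
    (hy : y ∈ homogPart K V n) : x * y ∈ homogPart K V (m + n) := by
  unfold homogPart
  rw [pow_add]
  exact Submodule.mul_mem_mul hx hy

theorem form_mem_homogPart (a : Module.Dual K V) : form a ∈ homogPart K V 1 := by
  simp [homogPart]

theorem algebraMap_mem_homogPart (r : K) :
    algebraMap K (CoordRing K V) r ∈ homogPart K V 0 := by
  simp [homogPart, Submodule.one_eq_range]

theorem mem_homogPart_zero {x : CoordRing K V} :
    x ∈ homogPart K V 0 ↔ ∃ r : K, algebraMap K _ r = x := by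
  simp [homogPart, Submodule.one_eq_range]

/-- The homomorphism `S → S[T]` sending each linear form `α` to `α T`; the coefficients of the
image of `x` are the homogeneous components of `x`. -/
noncomputable def twist (K V : Type*) [Field K] [AddCommGroup V] [Module K V] :
    CoordRing K V →ₐ[K] (CoordRing K V)[X] :=
  liftForm ((LinearMap.mulRight K (X : (CoordRing K V)[X])) ∘ₗ
    (CAlgHom : CoordRing K V →ₐ[K] (CoordRing K V)[X]).toLinearMap ∘ₗ form)

@[simp]
theorem twist_form (a : Module.Dual K V) : twist K V (form a) = C (form a) * X := by
  simp [twist]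

theorem twist_of_mem {n : ℕ} {x : CoordRing K V} (hx : x ∈ homogPart K V n) :
    twist K V x = C x * X ^ n := by
  induction n generalizing x with
  | zero =>
    obtain ⟨r, rfl⟩ := mem_homogPart_zero.1 hx
    rw [AlgHom.commutes, pow_zero, mul_one]
    rfl
  | succ n ih =>
    unfold homogPart at hx
    rw [pow_succ] at hx
    induction hx using Submodule.mul_induction_on' with
    | mem_mul_mem y hy z hz =>
      obtain ⟨a, rfl⟩ := hz
      rw [map_mul, ih hy, twist_form, map_mul]
      ring
    | add y _ z _ h1 h2 =>
      rw [map_add, h1, h2, map_add]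
      ring

theorem eval_one_twist (x : CoordRing K V) : (twist K V x).eval 1 = x := by
  have : ((aeval (1 : CoordRing K V)).restrictScalars K).comp (twist K V) = AlgHom.id K _ :=
    coordRing_algHom_ext fun a => by simp
  simpa [coe_aeval_eq_eval] using congrArg (fun F => F x) this

/-- The homogeneous component of degree `n`. -/
noncomputable def component (K V : Type*) [Field K] [AddCommGroup V] [Module K V] (n : ℕ) :
    CoordRing K V →ₗ[K] CoordRing K V :=
  ((lcoeff (CoordRing K V) n).restrictScalars K) ∘ₗ (twist K V).toLinearMap

theorem component_apply (n : ℕ) (x : CoordRing K V) :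
    component K V n x = (twist K V x).coeff n := rfl

theorem component_mem (n : ℕ) (x : CoordRing K V) : component K V n x ∈ homogPart K V n := by
  induction x using coordRing_induction generalizing n with
  | hK r =>
    rw [component_apply, twist_of_mem (algebraMap_mem_homogPart r), coeff_C_mul_X_pow]
    split_ifs with h
    · exact h ▸ algebraMap_mem_homogPart r
    · exact zero_mem _
  | hform a =>
    rw [component_apply, twist_of_mem (form_mem_homogPart a), coeff_C_mul_X_pow]
    split_ifs with h
    · exact h ▸ form_mem_homogPart a
    · exact zero_mem _
  | hmul x y hx hy =>
    rw [component_apply, map_mul, coeff_mul]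
    refine Submodule.sum_mem _ fun p hp => ?_
    rw [← Finset.HasAntidiagonal.mem_antidiagonal.1 hp]
    exact homogPart_mul (hx _) (hy _)
  | hadd x y hx hy =>
    rw [map_add]
    exact add_mem (hx _) (hy _)

theorem component_of_mem {n : ℕ} {x : CoordRing K V} (hx : x ∈ homogPart K V n) (m : ℕ) :
    component K V m x = if m = n then x else 0 := by
  rw [component_apply, twist_of_mem hx, coeff_C_mul_X_pow]

theorem homogPart_eq_of_ne_zero {m n : ℕ} {x : CoordRing K V} (hm : x ∈ homogPart K V m)
    (hn : x ∈ homogPart K V n) (hx : x ≠ 0) : m = n := by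
  have h1 := component_of_mem hm m
  rw [component_of_mem hn m, if_pos rfl] at h1
  by_contra h
  exact hx (by rw [← h1, if_neg h])

/-- The component of `S[-e]` of degree `t`. -/
noncomputable def shiftComponent (K V : Type*) [Field K] [AddCommGroup V] [Module K V]
    (e t : ℕ) : CoordRing K V →ₗ[K] CoordRing K V :=
  if e ≤ t then component K V (t - e) else 0

theorem shiftComponent_mem (e t : ℕ) (x : CoordRing K V) :
    shiftComponent K V e t x ∈ shiftedPart K V e t := by
  unfold shiftComponent shiftedPart
  split_ifs
  · exact component_mem _ _
  · exact zero_mem _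

theorem shiftComponent_of_mem {e t : ℕ} {x : CoordRing K V} (hx : x ∈ shiftedPart K V e t) :
    shiftComponent K V e t x = x := by
  unfold shiftComponent
  unfold shiftedPart at hx
  split_ifs at hx ⊢
  · rw [component_of_mem hx, if_pos rfl]
  · exact ((Submodule.mem_bot K).1 hx).symm

theorem component_mul {e : ℕ} {x : CoordRing K V} (hx : x ∈ homogPart K V e) (t : ℕ)
    (c : CoordRing K V) : component K V t (c * x) = shiftComponent K V e t c * x := by
  unfold shiftComponent
  rw [component_apply, map_mul, twist_of_mem hx, ← mul_assoc, coeff_mul_X_pow', coeff_mul_C]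
  split_ifs
  · rfl
  · simp

theorem shiftedPart_mul {e t : ℕ} {c x : CoordRing K V} (hc : c ∈ shiftedPart K V e t)
    (hx : x ∈ homogPart K V e) : c * x ∈ homogPart K V t := by
  rw [← shiftComponent_of_mem hc, ← component_mul hx]
  exact component_mem _ _

theorem shiftedPart_of_lt {e t : ℕ} (h : t < e) : shiftedPart K V e t = ⊥ := by
  rw [shiftedPart, if_neg (by omega)]

theorem shiftedPart_add (e n : ℕ) : shiftedPart K V e (e + n) = homogPart K V n := by
  rw [shiftedPart, if_pos (by omega), Nat.add_sub_cancel_left]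

theorem shiftedPart_succ_succ (e t : ℕ) :
    shiftedPart K V (e + 1) (t + 1) = shiftedPart K V e t := by
  simp [shiftedPart]

theorem shiftedPart_mul_shiftedPart {e s t : ℕ} {x y : CoordRing K V}
    (hx : x ∈ shiftedPart K V e s) (hy : y ∈ shiftedPart K V s t) :
    x * y ∈ shiftedPart K V e t := by
  rcases lt_or_ge s e with h | h
  · rw [shiftedPart_of_lt h] at hx
    rw [(Submodule.mem_bot K).1 hx, zero_mul]
    exact zero_mem _
  rcases lt_or_ge t s with h' | h'
  · rw [shiftedPart_of_lt h'] at hy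
    rw [(Submodule.mem_bot K).1 hy, mul_zero]
    exact zero_mem _
  obtain ⟨m, rfl⟩ := Nat.exists_eq_add_of_le h
  obtain ⟨n, rfl⟩ := Nat.exists_eq_add_of_le h'
  rw [shiftedPart_add] at hx hy
  rw [add_assoc, shiftedPart_add]
  exact homogPart_mul hx hy

theorem mem_shiftedPart_of_mul_mem {m q t : ℕ} {x c : CoordRing K V}
    (hx : x ∈ homogPart K V m) (hx0 : x ≠ 0) (h : c * x ∈ shiftedPart K V q t) :
    c ∈ shiftedPart K V (q + m) t := by
  suffices hc : c = shiftComponent K V (q + m) t c by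
    rw [hc]
    exact shiftComponent_mem _ _ _
  refine mul_right_cancel₀ hx0 ?_
  rw [← shiftComponent_of_mem h]
  rcases le_or_gt q t with hqt | hqt
  · obtain ⟨r, rfl⟩ := Nat.exists_eq_add_of_le hqt
    have e1 : shiftComponent K V q (q + r) = component K V r := by
      rw [shiftComponent, if_pos hqt, Nat.add_sub_cancel_left]
    have e2 : shiftComponent K V (q + m) (q + r) = shiftComponent K V m r := by
      unfold shiftComponent
      rw [Nat.add_sub_add_left]
      congr 1
      simp
    rw [e1, e2, component_mul hx]
  · rw [shiftComponent, shiftComponent, if_neg (by omega), if_neg (by omega)]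
    simp

/-- A factor of a nonzero homogeneous polynomial is homogeneous: its image under `twist` divides a
monomial in `T`. -/
theorem exists_mem_homogPart_of_mul {n : ℕ} {x y : CoordRing K V} (h : x * y ∈ homogPart K V n)
    (h0 : x * y ≠ 0) : ∃ m, x ∈ homogPart K V m := by
  have h1 := twist_of_mem h
  rw [map_mul] at h1
  have hx : twist K V x ≠ 0 := by
    intro h2
    have := eval_one_twist x
    rw [h2, eval_zero] at this
    exact h0 (by rw [← this, zero_mul])
  have hy : twist K V y ≠ 0 := by
    intro h2
    have := eval_one_twist y
    rw [h2, eval_zero] at this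
    exact h0 (by rw [← this, mul_zero])
  have hd := natDegree_mul hx hy
  have ht := natTrailingDegree_mul hx hy
  rw [h1, natDegree_C_mul_X_pow _ _ h0] at hd
  rw [h1, C_mul_X_pow_eq_monomial, natTrailingDegree_monomial h0] at ht
  have hx' := natTrailingDegree_le_natDegree (twist K V x)
  have hy' := natTrailingDegree_le_natDegree (twist K V y)
  refine ⟨(twist K V x).natDegree, ?_⟩
  have hmon : twist K V x =
      monomial (twist K V x).natDegree (component K V (twist K V x).natDegree x) := by
    ext k
    rw [coeff_monomial]
    split_ifs with hk
    · rw [← hk]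
      rfl
    · rcases lt_or_gt_of_ne hk with hk | hk
      · exact coeff_eq_zero_of_natDegree_lt hk
      · exact coeff_eq_zero_of_lt_natTrailingDegree (by omega)
  have h2 := eval_one_twist x
  rw [hmon, eval_monomial, one_pow, mul_one] at h2
  have h3 := component_mem (twist K V x).natDegree x
  rwa [h2] at h3

theorem isUnit_of_mem_homogPart_zero {x : CoordRing K V} (h : x ∈ homogPart K V 0) (h0 : x ≠ 0) :
    IsUnit x := by
  obtain ⟨r, rfl⟩ := mem_homogPart_zero.1 h
  refine (IsUnit.mk0 r ?_).map _
  rintro rfl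
  exact h0 (map_zero _)

theorem homogPart_le_irrelevantIdeal {n : ℕ} (hn : n ≠ 0) {x : CoordRing K V}
    (hx : x ∈ homogPart K V n) : x ∈ irrelevantIdeal K V := by
  obtain ⟨n, rfl⟩ := Nat.exists_eq_succ_of_ne_zero hn
  unfold homogPart at hx
  rw [Nat.succ_eq_add_one, pow_succ] at hx
  induction hx using Submodule.mul_induction_on' with
  | mem_mul_mem y hy z hz =>
    exact Ideal.mul_mem_left _ _ (Ideal.subset_span hz)
  | add y _ z _ h1 h2 => exact add_mem h1 h2

instance [FiniteDimensional K V] (n : ℕ) : FiniteDimensional K (homogPart K V n) := by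
  rw [FiniteDimensional, Module.Finite.iff_fg]
  exact Submodule.FG.pow (Module.Finite.iff_fg.1 inferInstance) n

instance [FiniteDimensional K V] (e t : ℕ) : FiniteDimensional K (shiftedPart K V e t) := by
  by_cases h : e ≤ t
  · rw [shiftedPart, if_pos h]
    infer_instance
  · rw [shiftedPart, if_neg h]
    infer_instance

/-- The Hilbert function of `S[-e]`. -/
noncomputable def hilb (K V : Type*) [Field K] [AddCommGroup V] [Module K V] (e t : ℕ) : ℕ :=
  Module.finrank K (shiftedPart K V e t)

theorem hilb_of_lt {e t : ℕ} (h : t < e) : hilb K V e t = 0 := by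
  rw [hilb, shiftedPart_of_lt h, finrank_bot]

theorem hilb_self (e : ℕ) : hilb K V e e = 1 := by
  have h : shiftedPart K V e e = Submodule.span K {1} := by
    have := shiftedPart_add (K := K) (V := V) e 0
    rw [add_zero] at this
    rw [this, homogPart, pow_zero, Submodule.one_eq_span]
  rw [hilb, h, finrank_span_singleton one_ne_zero]

end CoordRing

/-! ### Graded free modules -/

theorem finrank_map_add_finrank_inf_ker {K E F : Type*} [Field K] [AddCommGroup E] [Module K E]
    [AddCommGroup F] [Module K F] (Φ : E →ₗ[K] F) (P : Submodule K E) [FiniteDimensional K P] :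
    Module.finrank K (P.map Φ) + Module.finrank K (P ⊓ LinearMap.ker Φ : Submodule K E) =
      Module.finrank K P := by
  rw [← LinearMap.finrank_range_add_finrank_ker (Φ.domRestrict P), LinearMap.range_domRestrict,
    LinearMap.ker_domRestrict, ← Submodule.finrank_map_subtype_eq, Submodule.map_comap_subtype]

theorem finrank_map_of_injective {K E F : Type*} [Field K] [AddCommGroup E] [Module K E]
    [AddCommGroup F] [Module K F] {Φ : E →ₗ[K] F} (hΦ : Function.Injective Φ)
    (P : Submodule K E) : Module.finrank K (P.map Φ) = Module.finrank K P :=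
  (LinearEquiv.finrank_eq (Submodule.equivMapOfInjective Φ hΦ P)).symm

section Tuples

variable {K W : Type*} [Field K] [AddCommGroup W] [Module K W] {ι : Type*}

/-- The degree `t` part of the graded free module `⨁ S[-e k]`. -/
noncomputable def homogTuple (K W : Type*) [Field K] [AddCommGroup W] [Module K W] {ι : Type*}
    (e : ι → ℕ) (t : ℕ) : Submodule K (ι → CoordRing K W) :=
  Submodule.pi Set.univ fun k => shiftedPart K W (e k) t

theorem mem_homogTuple {e : ι → ℕ} {t : ℕ} {c : ι → CoordRing K W} :
    c ∈ homogTuple K W e t ↔ ∀ k, c k ∈ shiftedPart K W (e k) t := by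
  simp [homogTuple, Submodule.mem_pi]

theorem single_mem_homogTuple [DecidableEq ι] {e : ι → ℕ} {t : ℕ} {k : ι} {x : CoordRing K W}
    (hx : x ∈ shiftedPart K W (e k) t) : Pi.single k x ∈ homogTuple K W e t := by
  refine mem_homogTuple.2 fun l => ?_
  rcases eq_or_ne l k with rfl | h
  · rwa [Pi.single_eq_same]
  · rw [Pi.single_eq_of_ne h]
    exact zero_mem _

/-- The pieces of a graded free module are products of shifted pieces of the ring. -/
noncomputable def homogTupleEquiv (e : ι → ℕ) (t : ℕ) :
    homogTuple K W e t ≃ₗ[K] ∀ k, shiftedPart K W (e k) t where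
  toFun c := fun k => ⟨c.1 k, mem_homogTuple.1 c.2 k⟩
  invFun c := ⟨fun k => (c k).1, mem_homogTuple.2 fun k => (c k).2⟩
  map_add' _ _ := rfl
  map_smul' _ _ := rfl
  left_inv _ := rfl
  right_inv _ := rfl

variable [Fintype ι]

instance [FiniteDimensional K W] (e : ι → ℕ) (t : ℕ) :
    FiniteDimensional K (homogTuple K W e t) :=
  Module.Finite.equiv (homogTupleEquiv e t).symm

theorem finrank_homogTuple [FiniteDimensional K W] (e : ι → ℕ) (t : ℕ) :
    Module.finrank K (homogTuple K W e t) = ∑ k, hilb K W (e k) t := by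
  rw [(homogTupleEquiv e t).finrank_eq, Module.finrank_pi_fintype]
  rfl

variable {M : Type*} [AddCommGroup M] [Module (CoordRing K W) M] [Module K M]
  [IsScalarTower K (CoordRing K W) M]

/-- The linear combination map `c ↦ ∑ c k • g k`, as a `K`-linear map. -/
noncomputable def combo (K : Type*) {W : Type*} [Field K] [AddCommGroup W] [Module K W]
    {ι : Type*} [Fintype ι] {M : Type*} [AddCommGroup M] [Module (CoordRing K W) M] [Module K M]
    [IsScalarTower K (CoordRing K W) M] (g : ι → M) : (ι → CoordRing K W) →ₗ[K] M :=
  (Fintype.linearCombination (CoordRing K W) g).restrictScalars K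

theorem combo_apply (g : ι → M) (c : ι → CoordRing K W) : combo K g c = ∑ k, c k • g k := rfl

theorem combo_single [DecidableEq ι] (g : ι → M) (k : ι) (x : CoordRing K W) :
    combo K g (Pi.single k x) = x • g k := by
  rw [combo_apply, Finset.sum_eq_single k]
  · rw [Pi.single_eq_same]
  · intro l _ h
    rw [Pi.single_eq_of_ne h, zero_smul]
  · simp

end Tuples

/-! ### Graded ideals and their Hilbert functions -/

section Core

variable {K W : Type*} [Field K] [AddCommGroup W] [Module K W] {ι : Type*} [Fintype ι]

/-- The degree `t` part of the ideal generated by homogeneous elements `f k` of degrees `e k`. -/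
noncomputable def idealPart (e : ι → ℕ) (f : ι → CoordRing K W) (t : ℕ) :
    Submodule K (CoordRing K W) :=
  (homogTuple K W e t).map (combo K f)

instance [FiniteDimensional K W] (e : ι → ℕ) (f : ι → CoordRing K W) (t : ℕ) :
    FiniteDimensional K (idealPart e f t) := by
  unfold idealPart
  infer_instance

theorem finrank_idealPart [FiniteDimensional K W] (e : ι → ℕ) (f : ι → CoordRing K W) (t : ℕ) :
    Module.finrank K (idealPart e f t) +
      Module.finrank K (homogTuple K W e t ⊓ LinearMap.ker (combo K f) : Submodule K _) =
      ∑ k, hilb K W (e k) t := by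
  rw [← finrank_homogTuple]
  exact finrank_map_add_finrank_inf_ker (combo K f) _

theorem mul_mem_idealPart {e : ι → ℕ} {f : ι → CoordRing K W} {t : ℕ} {k : ι}
    {c : CoordRing K W} (hc : c ∈ shiftedPart K W (e k) t) : c * f k ∈ idealPart e f t := by
  classical
  exact ⟨Pi.single k c, single_mem_homogTuple hc, combo_single f k c⟩

theorem one_mem_shiftedPart (e : ℕ) : (1 : CoordRing K W) ∈ shiftedPart K W e e := by
  have := shiftedPart_add (K := K) (V := W) e 0
  rw [add_zero] at this
  rw [this, ← map_one (algebraMap K (CoordRing K W))]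
  exact algebraMap_mem_homogPart 1

theorem gen_mem_idealPart (e : ι → ℕ) (f : ι → CoordRing K W) (k : ι) :
    f k ∈ idealPart e f (e k) := by
  simpa using mul_mem_idealPart (f := f) (one_mem_shiftedPart (K := K) (W := W) (e k))

theorem mul_mem_idealPart_of_mem {e : ι → ℕ} {f : ι → CoordRing K W} {s t : ℕ}
    {x c : CoordRing K W} (hx : x ∈ idealPart e f s) (hc : c ∈ shiftedPart K W s t) :
    c * x ∈ idealPart e f t := by
  obtain ⟨y, hy, rfl⟩ := hx
  refine ⟨c • y, mem_homogTuple.2 fun k => ?_, ?_⟩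
  · rw [Pi.smul_apply, smul_eq_mul, mul_comm]
    exact shiftedPart_mul_shiftedPart (mem_homogTuple.1 hy k) hc
  · rw [combo_apply, combo_apply, Finset.mul_sum]
    refine Finset.sum_congr rfl fun k _ => ?_
    simp [mul_assoc]

/-- A homogeneous ideal lies in degree `t` in a space `P` as soon as the multiples of its
generators of degree at most `t` do. -/
theorem idealPart_le {e : ι → ℕ} {f : ι → CoordRing K W} {t : ℕ}
    {P : Submodule K (CoordRing K W)}
    (h : ∀ k, e k ≤ t → ∀ c ∈ shiftedPart K W (e k) t, c * f k ∈ P) : idealPart e f t ≤ P := by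
  rintro _ ⟨c, hc, rfl⟩
  rw [combo_apply]
  refine Submodule.sum_mem _ fun k _ => ?_
  have hck := mem_homogTuple.1 hc k
  rcases lt_or_ge t (e k) with hk | hk
  · rw [shiftedPart_of_lt hk] at hck
    rw [(Submodule.mem_bot K).1 hck, zero_smul]
    exact zero_mem _
  · exact h k hk _ hck

/-- The Hilbert function of an ideal with two generators `g u`, `g v`, with `u` and `v` coprime:
its syzygies are generated by `(v, -u)`. -/
theorem finrank_idealPart_pair [FiniteDimensional K W] {p q m n : ℕ} {g u v : CoordRing K W}
    (hg : g ≠ 0) (hu0 : u ≠ 0) (hu : u ∈ homogPart K W m) (hv : v ∈ homogPart K W n)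
    (huv : IsRelPrime u v) (hpq : p + n = q + m) (t : ℕ) :
    Module.finrank K (idealPart ![p, q] ![g * u, g * v] t) + hilb K W (p + n) t =
      hilb K W p t + hilb K W q t := by
  have h1 := finrank_idealPart ![p, q] ![g * u, g * v] t
  rw [Fin.sum_univ_two] at h1
  simp only [Matrix.cons_val_zero, Matrix.cons_val_one] at h1
  rw [← h1]
  congr 1
  let Φ : CoordRing K W →ₗ[K] (Fin 2 → CoordRing K W) :=
    LinearMap.pi ![LinearMap.mulRight K v, -LinearMap.mulRight K u]
  have hΦ0 : ∀ z, Φ z 0 = z * v := fun z => rfl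
  have hΦ1 : ∀ z, Φ z 1 = -(z * u) := fun z => rfl
  have hinj : Function.Injective Φ := by
    intro x y h
    have := congrFun h 1
    rw [hΦ1, hΦ1, neg_inj] at this
    exact mul_right_cancel₀ hu0 this
  suffices heq : (shiftedPart K W (p + n) t).map Φ =
      homogTuple K W ![p, q] t ⊓ LinearMap.ker (combo K ![g * u, g * v]) by
    rw [hilb, ← finrank_map_of_injective hinj, heq]
  ext c
  constructor
  · rintro ⟨z, hz, rfl⟩
    refine ⟨mem_homogTuple.2 fun k => ?_, ?_⟩
    · fin_cases k
      · change Φ z 0 ∈ shiftedPart K W p t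
        rw [hΦ0, mul_comm]
        refine shiftedPart_mul_shiftedPart (s := p + n) ?_ hz
        rwa [shiftedPart_add]
      · change Φ z 1 ∈ shiftedPart K W q t
        rw [hΦ1, mul_comm]
        refine neg_mem (shiftedPart_mul_shiftedPart (s := p + n) ?_ hz)
        rwa [hpq, shiftedPart_add]
    · change Φ z ∈ LinearMap.ker (combo K ![g * u, g * v])
      rw [LinearMap.mem_ker, combo_apply, Fin.sum_univ_two, hΦ0, hΦ1]
      simp only [Matrix.cons_val_zero, Matrix.cons_val_one, smul_eq_mul]
      ring
  · rintro ⟨hc, hk⟩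
    replace hk := LinearMap.mem_ker.1 hk
    rw [combo_apply, Fin.sum_univ_two] at hk
    simp only [Matrix.cons_val_zero, Matrix.cons_val_one, smul_eq_mul] at hk
    have h2 : c 0 * u = -(c 1 * v) :=
      mul_left_cancel₀ hg (by linear_combination hk)
    obtain ⟨z, hz⟩ : u ∣ c 1 := by
      refine huv.dvd_of_dvd_mul_right ?_
      exact ⟨-c 0, by linear_combination h2⟩
    have h3 : c 0 = -(z * v) :=
      mul_right_cancel₀ hu0 (by rw [h2, hz]; ring)
    have h4 : c 1 = z * u := by rw [hz, mul_comm]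
    have hc1 := mem_homogTuple.1 hc 1
    change c 1 ∈ shiftedPart K W q t at hc1
    rw [h4] at hc1
    refine ⟨-z, neg_mem (hpq ▸ mem_shiftedPart_of_mul_mem hu hu0 hc1), ?_⟩
    ext k
    fin_cases k
    · change Φ (-z) 0 = c 0
      rw [hΦ0, h3]; ring
    · change Φ (-z) 1 = c 1
      rw [hΦ1, h4]; ring

variable [FiniteDimensional K W]

/-- Suppose that the syzygies of homogeneous polynomials `f k` of degrees `e k` have the Hilbert
function of the graded free module obtained from `⨁ S[-e k]` by removing `S[-p]` and `S[-q]` and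
adding `S[-D]`, where `p ≤ q < D` and no degree `e k` lies strictly between `q` and `D`. Then the
ideal `(f k)` is generated by two of the `f k`, of degrees `p` and `q`, and the coprime parts `u`,
`v` of these give a syzygy of degree `D`. -/
theorem exists_two_generators (e : ι → ℕ) (f : ι → CoordRing K W)
    (hf : ∀ k, f k ∈ homogPart K W (e k)) {p q D : ℕ} (hpq : p ≤ q) (hqD : q < D)
    (hgap : ∀ k, e k < D → e k ≤ q)
    (hdim : ∀ t, Module.finrank K
        (homogTuple K W e t ⊓ LinearMap.ker (combo K f) : Submodule K _) +
        hilb K W p t + hilb K W q t = ∑ k, hilb K W (e k) t + hilb K W D t) :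
    ∃ (i j : ι) (u v : CoordRing K W), i ≠ j ∧ e i = p ∧ e j = q ∧ f i ≠ 0 ∧ u ≠ 0 ∧ v ≠ 0 ∧
      u ∈ shiftedPart K W q D ∧ v ∈ shiftedPart K W p D ∧ IsRelPrime u v ∧
      v * f i = u * f j ∧
      ∃ P Q : ι → CoordRing K W, ∀ k, P k ∈ shiftedPart K W p (e k) ∧
        Q k ∈ shiftedPart K W q (e k) ∧ f k = P k * f i + Q k * f j := by
  have hI : ∀ t, Module.finrank K (idealPart e f t) + hilb K W D t =
      hilb K W p t + hilb K W q t := by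
    intro t
    have h1 := finrank_idealPart e f t
    have h2 := hdim t
    omega
  -- a nonzero generator `f i` of degree `p`
  obtain ⟨i, hei, hfi⟩ : ∃ i, e i = p ∧ f i ≠ 0 := by
    by_contra! hcon
    have hle : idealPart e f p ≤ ⊥ := by
      refine idealPart_le fun k hk c _ => ?_
      rcases hk.eq_or_lt with hk | hk
      · rw [hcon k hk, mul_zero]
        exact zero_mem _
      · have h1 := hI (e k)
        rw [hilb_of_lt hk, hilb_of_lt (hk.trans_le hpq)] at h1
        have h2 : idealPart e f (e k) = ⊥ := Submodule.finrank_eq_zero.1 (by omega)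
        have h3 := gen_mem_idealPart e f k
        rw [h2, Submodule.mem_bot] at h3
        rw [h3, mul_zero]
        exact zero_mem _
    have h1 := hI p
    rw [le_bot_iff.1 hle, finrank_bot, hilb_self, hilb_of_lt (hpq.trans_lt hqD)] at h1
    omega
  have hinj : Function.Injective (LinearMap.mulRight K (f i)) := fun x y h =>
    mul_right_cancel₀ hfi h
  have hprin : ∀ t, (shiftedPart K W p t).map (LinearMap.mulRight K (f i)) ≤ idealPart e f t := by
    rintro t _ ⟨c, hc, rfl⟩
    exact mul_mem_idealPart (by rw [hei]; exact hc)
  have hprin_dim : ∀ t, Module.finrank K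
      ((shiftedPart K W p t).map (LinearMap.mulRight K (f i))) = hilb K W p t := fun t =>
    finrank_map_of_injective hinj _
  -- a generator `f j` of degree `q` that is no multiple of `f i`
  obtain ⟨j, hej, hfj⟩ : ∃ j, e j = q ∧ ¬ f i ∣ f j := by
    by_contra! hcon
    have hle : idealPart e f q ≤ (shiftedPart K W p q).map (LinearMap.mulRight K (f i)) := by
      refine idealPart_le fun k hk c hc => ?_
      have hmem : f k ∈ (shiftedPart K W p (e k)).map (LinearMap.mulRight K (f i)) := by
        rcases hk.eq_or_lt with hk | hk
        · obtain ⟨z, hz⟩ := hcon k hk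
          refine ⟨shiftComponent K W p (e k) z, shiftComponent_mem _ _ _, ?_⟩
          rw [LinearMap.mulRight_apply, ← component_mul (hei ▸ hf i), mul_comm, ← hz,
            component_of_mem (hf k), if_pos rfl]
        · have h1 := hI (e k)
          rw [hilb_of_lt hk, hilb_of_lt (hk.trans hqD)] at h1
          rw [Submodule.eq_of_le_of_finrank_le (hprin (e k)) (by rw [hprin_dim]; omega)]
          exact gen_mem_idealPart e f k
      obtain ⟨z, hz, hzk⟩ := hmem
      refine ⟨z * c, shiftedPart_mul_shiftedPart hz hc, ?_⟩
      rw [← hzk, LinearMap.mulRight_apply, LinearMap.mulRight_apply]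
      ring
    have h1 := hI q
    have h2 := Submodule.finrank_mono hle
    rw [hprin_dim] at h2
    rw [hilb_self, hilb_of_lt hqD] at h1
    omega
  obtain ⟨u, v, g, huv, hgu, hgv⟩ :=
    UniqueFactorizationMonoid.exists_reduced_factors (f i) hfi (f j)
  have hfj0 : f j ≠ 0 := fun h => hfj (h ▸ dvd_zero _)
  have hg0 : g ≠ 0 := by
    rintro rfl
    exact hfi (by rw [← hgu, zero_mul])
  have hu0 : u ≠ 0 := by
    rintro rfl
    exact hfi (by rw [← hgu, mul_zero])
  have hv0 : v ≠ 0 := by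
    rintro rfl
    exact hfj0 (by rw [← hgv, mul_zero])
  obtain ⟨a, hga⟩ := exists_mem_homogPart_of_mul (x := g) (y := u) (hgu ▸ hf i) (hgu ▸ hfi)
  obtain ⟨m, hum⟩ := exists_mem_homogPart_of_mul (x := u) (y := g)
    (by rw [mul_comm, hgu]; exact hf i) (by rw [mul_comm, hgu]; exact hfi)
  obtain ⟨n, hvn⟩ := exists_mem_homogPart_of_mul (x := v) (y := g)
    (by rw [mul_comm, hgv]; exact hf j) (by rw [mul_comm, hgv]; exact hfj0)
  have ham : a + m = p := by
    rw [← hei]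
    exact homogPart_eq_of_ne_zero (hgu ▸ homogPart_mul hga hum) (hf i) hfi
  have han : a + n = q := by
    rw [← hej]
    exact homogPart_eq_of_ne_zero (hgv ▸ homogPart_mul hga hvn) (hf j) hfj0
  have hm : m ≠ 0 := by
    rintro rfl
    refine hfj (dvd_trans ?_ (hgv ▸ dvd_mul_right g v))
    rw [← hgu]
    exact (isUnit_of_mem_homogPart_zero hum hu0).mul_right_dvd.2 dvd_rfl
  have hJ := finrank_idealPart_pair (p := p) (q := q) hg0 hu0 hum hvn huv (by omega)
  rw [hgu, hgv] at hJ
  have hJI : ∀ t, idealPart ![p, q] ![f i, f j] t ≤ idealPart e f t := by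
    refine fun t => idealPart_le fun k _ c hc => ?_
    fin_cases k
    · exact mul_mem_idealPart (by rw [hei]; exact hc)
    · exact mul_mem_idealPart (by rw [hej]; exact hc)
  have hlow : ∀ k, e k < D → f k ∈ idealPart ![p, q] ![f i, f j] (e k) := by
    intro k hk
    have h1 := hI (e k)
    have h2 := hJ (e k)
    rw [hilb_of_lt (by have := hgap k hk; omega)] at h2
    rw [Submodule.eq_of_le_of_finrank_le (hJI (e k)) (by omega)]
    exact gen_mem_idealPart e f k
  have hD : D = p + n := by
    rcases lt_trichotomy D (p + n) with h | h | h
    · have h1 := hI D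
      have h2 := hJ D
      rw [hilb_self] at h1
      rw [hilb_of_lt h] at h2
      have := Submodule.finrank_mono (hJI D)
      omega
    · exact h
    · have h1 := hI (p + n)
      have h2 := hJ (p + n)
      rw [hilb_of_lt h] at h1
      rw [hilb_self] at h2
      have hle : idealPart e f (p + n) ≤ idealPart ![p, q] ![f i, f j] (p + n) :=
        idealPart_le fun k hk c hc => mul_mem_idealPart_of_mem (hlow k (hk.trans_lt h)) hc
      have := Submodule.finrank_mono hle
      omega
  have hIJ : ∀ k, f k ∈ idealPart ![p, q] ![f i, f j] (e k) := by
    intro k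
    have h1 := hI (e k)
    have h2 := hJ (e k)
    rw [← hD] at h2
    rw [Submodule.eq_of_le_of_finrank_le (hJI (e k)) (by omega)]
    exact gen_mem_idealPart e f k
  choose c hc hcf using hIJ
  refine ⟨i, j, u, v, ?_, hei, hej, hfi, hu0, hv0, ?_, ?_, huv, ?_, fun k => c k 0,
    fun k => c k 1, fun k => ⟨mem_homogTuple.1 (hc k) 0, mem_homogTuple.1 (hc k) 1, ?_⟩⟩
  · rintro rfl
    exact hfj dvd_rfl
  · rw [hD, show p + n = q + m by omega, shiftedPart_add]
    exact hum
  · rw [hD, shiftedPart_add]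
    exact hvn
  · rw [← hgu, ← hgv]; ring
  · rw [← hcf k, combo_apply, Fin.sum_univ_two]
    simp

end Core

/-! ### Derivations of the coordinate ring -/

section Derivations

variable {K V : Type*} [Field K] [AddCommGroup V] [Module K V]

theorem der_ext {θ η : Der K V} (h : ∀ a, θ (form a) = η (form a)) : θ = η := by
  ext x
  induction x using coordRing_induction with
  | hK r => rw [Derivation.map_algebraMap, Derivation.map_algebraMap]
  | hform a => exact h a
  | hmul x y hx hy => rw [Derivation.leibniz, Derivation.leibniz, hx, hy]
  | hadd x y hx hy => rw [map_add, map_add, hx, hy]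

theorem exists_der (f : Module.Dual K V →ₗ[K] CoordRing K V) :
    ∃ θ : Der K V, ∀ a, θ (form a) = f a := by
  -- the homomorphism `x ↦ x + θ x ε` into the dual numbers over `S`
  let F : CoordRing K V →ₐ[K] TrivSqZeroExt (CoordRing K V) (CoordRing K V) :=
    liftForm ((TrivSqZeroExt.inlAlgHom K (CoordRing K V) (CoordRing K V)).toLinearMap ∘ₗ form +
      ((TrivSqZeroExt.inrHom (CoordRing K V) (CoordRing K V)).restrictScalars K) ∘ₗ f)
  have hF : ∀ a, F (form a) = TrivSqZeroExt.inl (form a) + TrivSqZeroExt.inr (f a) := fun a =>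
    liftForm_form _ _
  have hfst : ∀ x, (F x).fst = x := by
    intro x
    have : (TrivSqZeroExt.fstHom K (CoordRing K V) (CoordRing K V)).comp F = AlgHom.id K _ :=
      coordRing_algHom_ext fun a => by simp [hF]
    exact congrArg (fun G => G x) this
  refine ⟨Derivation.mk' ((TrivSqZeroExt.sndHom (CoordRing K V) (CoordRing K V)).restrictScalars K
    ∘ₗ F.toLinearMap) ?_, ?_⟩
  · intro x y
    simp [hfst, mul_comm]
  · intro a
    simp [hF]

theorem combo_der_apply {ι : Type*} [Fintype ι] (g : ι → Der K V) (c : ι → CoordRing K V)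
    (x : CoordRing K V) : combo K g c x = ∑ k, c k * g k x := by
  rw [combo_apply, ← Derivation.coeFnAddMonoidHom_apply, map_sum, Finset.sum_apply]
  rfl

/-- Homogeneous combinations of homogeneous derivations have homogeneous coefficients, up to a
relation. -/
theorem combo_shiftComponent {ι : Type*} [Fintype ι] {e : ι → ℕ} {g : ι → Der K V}
    (hg : ∀ k, IsHomogDer (e k) (g k)) {t : ℕ} {c : ι → CoordRing K V}
    (h : IsHomogDer t (combo K g c)) :
    combo K g (fun k => shiftComponent K V (e k) t (c k)) = combo K g c := by
  refine der_ext fun a => ?_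
  have h1 := component_of_mem (h a) t
  rw [if_pos rfl] at h1
  rw [← h1, combo_der_apply, combo_der_apply, map_sum]
  exact Finset.sum_congr rfl fun k _ => (component_mul (hg k a) t (c k)).symm

theorem isHomogDer_combo {ι : Type*} [Fintype ι] {e : ι → ℕ} {g : ι → Der K V}
    (hg : ∀ k, IsHomogDer (e k) (g k)) {t : ℕ} {c : ι → CoordRing K V}
    (hc : c ∈ homogTuple K V e t) : IsHomogDer t (combo K g c) := by
  intro a
  rw [combo_der_apply]
  exact Submodule.sum_mem _ fun k _ => shiftedPart_mul (mem_homogTuple.1 hc k) (hg k a)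

theorem isHomogDer_smul {s t : ℕ} {θ : Der K V} (hθ : IsHomogDer s θ) {c : CoordRing K V}
    (hc : c ∈ shiftedPart K V s t) : IsHomogDer t (c • θ) := fun b => by
  rw [Derivation.smul_apply, smul_eq_mul]
  exact shiftedPart_mul hc (hθ b)

theorem isHomogDer_sub {t : ℕ} {θ η : Der K V} (hθ : IsHomogDer t θ) (hη : IsHomogDer t η) :
    IsHomogDer t (θ - η) := fun b => sub_mem (hθ b) (hη b)

end Derivations

/-! ### Restriction to a hyperplane -/

section Restriction

variable {K V : Type*} [Field K] [AddCommGroup V] [Module K V]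

theorem exists_smul_of_ker_le {a b : Module.Dual K V} (h : LinearMap.ker a ≤ LinearMap.ker b) :
    ∃ c : K, b = c • a := by
  have h1 := mem_span_of_iInf_ker_le_ker (L := fun _ : Unit => a) (K := b) (by simpa using h)
  rw [Set.range_const, Submodule.mem_span_singleton] at h1
  obtain ⟨c, hc⟩ := h1
  exact ⟨c, hc.symm⟩

theorem map_mem_homogPart {W : Type*} [AddCommGroup W] [Module K W]
    {F : CoordRing K V →ₐ[K] CoordRing K W} (hF : ∀ a, F (form a) ∈ homogPart K W 1) {n : ℕ}
    {x : CoordRing K V} (hx : x ∈ homogPart K V n) : F x ∈ homogPart K W n := by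
  induction n generalizing x with
  | zero =>
    obtain ⟨r, rfl⟩ := mem_homogPart_zero.1 hx
    rw [AlgHom.commutes]
    exact algebraMap_mem_homogPart r
  | succ n ih =>
    unfold homogPart at hx
    rw [pow_succ] at hx
    induction hx using Submodule.mul_induction_on' with
    | mem_mul_mem y hy z hz =>
      obtain ⟨a, rfl⟩ := hz
      rw [map_mul]
      exact homogPart_mul (ih hy) (hF a)
    | add y _ z _ h1 h2 =>
      rw [map_add]
      exact add_mem h1 h2

theorem map_mem_shiftedPart {W : Type*} [AddCommGroup W] [Module K W]
    {F : CoordRing K V →ₐ[K] CoordRing K W} (hF : ∀ a, F (form a) ∈ homogPart K W 1) {e t : ℕ}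
    {x : CoordRing K V} (hx : x ∈ shiftedPart K V e t) : F x ∈ shiftedPart K W e t := by
  unfold shiftedPart at hx ⊢
  split_ifs at hx ⊢
  · exact map_mem_homogPart hF hx
  · rw [(Submodule.mem_bot K).1 hx, map_zero]
    exact zero_mem _

/-- The restriction of polynomials to a subspace. -/
noncomputable def res (H : Submodule K V) : CoordRing K V →ₐ[K] CoordRing K H :=
  liftForm (form ∘ₗ H.dualRestrict)

@[simp]
theorem res_form (H : Submodule K V) (b : Module.Dual K V) :
    res H (form b) = form (H.dualRestrict b) :=
  liftForm_form _ _

theorem res_form_mem (H : Submodule K V) (b : Module.Dual K V) :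
    res H (form b) ∈ homogPart K H 1 := by
  rw [res_form]
  exact form_mem_homogPart _

/-- Polynomials on a subspace extend, compatibly with products and degrees. -/
theorem exists_section_res (H : Submodule K V) :
    ∃ σ : CoordRing K H →ₐ[K] CoordRing K V, (∀ x, res H (σ x) = x) ∧
      ∀ b, ∃ b', σ (form b) = form b' := by
  obtain ⟨s, hs⟩ := H.dualRestrict.exists_rightInverse_of_surjective
    (LinearMap.range_eq_top.2 Subspace.dualRestrict_surjective)
  refine ⟨liftForm (form ∘ₗ s), ?_, ?_⟩
  · intro x
    have : (res H).comp (liftForm (form ∘ₗ s)) = AlgHom.id K _ :=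
      coordRing_algHom_ext fun b => by
        simpa using congrArg form (LinearMap.congr_fun hs b)
    exact congrArg (fun G => G x) this
  · intro b
    exact ⟨s b, liftForm_form _ _⟩

theorem res_surjective (H : Submodule K V) : Function.Surjective (res H) := fun x => by
  obtain ⟨σ, h, -⟩ := exists_section_res H
  exact ⟨σ x, h x⟩

theorem exists_res_eq {H : Submodule K V} {e t : ℕ} {x : CoordRing K H}
    (hx : x ∈ shiftedPart K H e t) : ∃ y ∈ shiftedPart K V e t, res H y = x := by
  obtain ⟨σ, h, hσ⟩ := exists_section_res H
  refine ⟨σ x, map_mem_shiftedPart (fun b => ?_) hx, h x⟩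
  obtain ⟨b', hb'⟩ := hσ b
  exact hb' ▸ form_mem_homogPart b'

theorem dualRestrict_ker_self (a : Module.Dual K V) :
    (LinearMap.ker a).dualRestrict a = 0 := by
  ext x
  exact x.2

theorem dualRestrict_eq_zero_iff {H : Submodule K V} {b : Module.Dual K V} :
    H.dualRestrict b = 0 ↔ H ≤ LinearMap.ker b := by
  constructor
  · intro h x hx
    exact LinearMap.congr_fun h ⟨x, hx⟩
  · intro h
    ext x
    exact h x.2

theorem form_dvd_form_of_ker_le {a b : Module.Dual K V}
    (h : LinearMap.ker a ≤ LinearMap.ker b) : form a ∣ form b := by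
  obtain ⟨c, rfl⟩ := exists_smul_of_ker_le h
  rw [map_smul, Algebra.smul_def]
  exact dvd_mul_left _ _

theorem res_eq_zero_iff {H : Submodule K V} {a : Module.Dual K V} (ha : H = LinearMap.ker a)
    {x : CoordRing K V} : res H x = 0 ↔ form a ∣ x := by
  subst ha
  constructor
  · intro hx
    obtain ⟨σ, h, hσ⟩ := exists_section_res (LinearMap.ker a)
    -- modulo `a`, the identity and `σ ∘ res` agree on linear forms
    let π := Ideal.Quotient.mkₐ K (Ideal.span {form a})
    have hπ : π = (π.comp σ).comp (res _) := by
      refine coordRing_algHom_ext fun b => ?_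
      obtain ⟨b', hb'⟩ := hσ ((LinearMap.ker a).dualRestrict b)
      have h2 := h (form ((LinearMap.ker a).dualRestrict b))
      rw [hb', res_form] at h2
      have h3 : (LinearMap.ker a).dualRestrict (b - b') = 0 := by
        rw [map_sub, form_injective h2, sub_self]
      have h4 := form_dvd_form_of_ker_le (dualRestrict_eq_zero_iff.1 h3)
      rw [map_sub] at h4
      rw [AlgHom.comp_apply, AlgHom.comp_apply, res_form, hb']
      exact Ideal.Quotient.eq.2 (Ideal.mem_span_singleton.2 h4)
    have h1 : π x = 0 := by
      rw [hπ, AlgHom.comp_apply, hx, map_zero]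
    exact Ideal.mem_span_singleton.1 (Ideal.Quotient.eq_zero_iff_mem.1 h1)
  · rintro ⟨y, rfl⟩
    rw [map_mul, res_form, dualRestrict_ker_self, map_zero, zero_mul]

theorem form_ne_zero {a : Module.Dual K V} (ha : a ≠ 0) : form a ≠ 0 := fun h =>
  ha (form_injective (h.trans (map_zero _).symm))

theorem prime_form {a : Module.Dual K V} (ha : a ≠ 0) : Prime (form a) := by
  refine ⟨form_ne_zero ha, fun hu => ?_, fun x y h => ?_⟩
  · have h1 := hu.map (res (LinearMap.ker a))
    rw [(res_eq_zero_iff rfl).2 dvd_rfl] at h1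
    exact not_isUnit_zero h1
  · rw [← res_eq_zero_iff rfl, map_mul, mul_eq_zero] at h
    rwa [← res_eq_zero_iff rfl, ← res_eq_zero_iff rfl]

theorem ker_le_of_form_dvd_form {a b : Module.Dual K V} (h : form a ∣ form b) :
    LinearMap.ker a ≤ LinearMap.ker b := by
  rw [← res_eq_zero_iff rfl, res_form] at h
  exact dualRestrict_eq_zero_iff.1 (form_injective (h.trans (map_zero _).symm))

/-- The Hilbert function of a hyperplane is the first difference of that of the ambient space. -/
theorem hilb_eq_add [FiniteDimensional K V] {H : Submodule K V} {a : Module.Dual K V}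
    (ha0 : a ≠ 0) (ha : H = LinearMap.ker a) (e t : ℕ) :
    hilb K V e t = hilb K V (e + 1) t + hilb K H e t := by
  have h1 := finrank_map_add_finrank_inf_ker (res H).toLinearMap (shiftedPart K V e t)
  have h2 : (shiftedPart K V e t).map (res H).toLinearMap = shiftedPart K H e t := by
    ext x
    constructor
    · rintro ⟨y, hy, rfl⟩
      exact map_mem_shiftedPart (res_form_mem H) hy
    · intro hx
      obtain ⟨y, hy, rfl⟩ := exists_res_eq hx
      exact ⟨y, hy, rfl⟩
  have hinj : Function.Injective (LinearMap.mulRight K (form a)) := fun x y h =>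
    mul_right_cancel₀ (form_ne_zero ha0) h
  have h3 : shiftedPart K V e t ⊓ LinearMap.ker (res H).toLinearMap =
      (shiftedPart K V (e + 1) t).map (LinearMap.mulRight K (form a)) := by
    ext x
    constructor
    · rintro ⟨hx, hx0⟩
      obtain ⟨y, rfl⟩ := (res_eq_zero_iff ha).1 hx0
      rw [mul_comm] at hx
      exact ⟨y, mem_shiftedPart_of_mul_mem (form_mem_homogPart a) (form_ne_zero ha0) hx,
        mul_comm _ _⟩
    · rintro ⟨y, hy, rfl⟩
      refine ⟨?_, (res_eq_zero_iff ha).2 (dvd_mul_left _ _)⟩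
      rw [LinearMap.mulRight_apply, mul_comm]
      refine shiftedPart_mul_shiftedPart (s := e + 1) ?_ hy
      rw [shiftedPart_add]
      exact form_mem_homogPart a
  rw [h2, h3, finrank_map_of_injective hinj] at h1
  rw [hilb, ← h1, add_comm]
  rfl

end Restriction

/-! ### Logarithmic derivations and restriction -/

section Log

variable {K V : Type*} [Field K] [AddCommGroup V] [Module K V]

theorem mem_logDer {A : Finset (Submodule K V)} {θ : Der K V} :
    θ ∈ logDer A ↔ ∀ L ∈ A, ∀ b : Module.Dual K V, L = LinearMap.ker b →
      form b ∣ θ (form b) := by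
  simp only [← Ideal.mem_span_singleton]
  rfl

theorem dvd_der_of_ker_eq {b b' : Module.Dual K V} (h : LinearMap.ker b = LinearMap.ker b')
    {θ : Der K V} (hθ : form b ∣ θ (form b)) : form b' ∣ θ (form b') := by
  obtain ⟨c, rfl⟩ := exists_smul_of_ker_le h.le
  refine (form_dvd_form_of_ker_le h.ge).trans (hθ.trans ?_)
  rw [map_smul, Derivation.map_smul, Algebra.smul_def]
  exact dvd_mul_left _ _

/-- It suffices to test logarithmic derivations on one linear form for each hyperplane. -/
theorem mem_logDer_of_forms {A : Finset (Submodule K V)} {α : Submodule K V → Module.Dual K V}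
    (hα : ∀ L ∈ A, L = LinearMap.ker (α L)) {θ : Der K V}
    (h : ∀ L ∈ A, form (α L) ∣ θ (form (α L))) : θ ∈ logDer A :=
  mem_logDer.2 fun L hL _ hb => dvd_der_of_ker_eq ((hα L hL).symm.trans hb) (h L hL)

theorem exists_forms {A : Finset (Submodule K V)} (hA : IsArrangement A) :
    ∃ α : Submodule K V → Module.Dual K V, ∀ L ∈ A, α L ≠ 0 ∧ L = LinearMap.ker (α L) := by
  choose! α hα using hA
  exact ⟨α, hα⟩

theorem mem_deletion {A : Finset (Submodule K V)} {H L : Submodule K V} :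
    L ∈ deletion A H ↔ L ≠ H ∧ L ∈ A := by
  simp [deletion]

theorem mem_restriction {A : Finset (Submodule K V)} {H : Submodule K V} {X : Submodule K H} :
    X ∈ restriction A H ↔ ∃ L ∈ deletion A H, Submodule.comap H.subtype L = X := by
  simp [restriction]

theorem ker_dualRestrict (H : Submodule K V) (b : Module.Dual K V) :
    LinearMap.ker (H.dualRestrict b) = Submodule.comap H.subtype (LinearMap.ker b) := by
  ext x
  rfl

theorem ker_eq_of_ker_le {a b : Module.Dual K V} (hb : b ≠ 0)
    (h : LinearMap.ker a ≤ LinearMap.ker b) : LinearMap.ker a = LinearMap.ker b := by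
  obtain ⟨c, rfl⟩ := exists_smul_of_ker_le h
  have hc : c ≠ 0 := by
    rintro rfl
    exact hb (zero_smul _ _)
  exact (LinearMap.ker_smul a c hc).symm

/-- `D(A)` consists of the `θ ∈ D(A ∖ {H})` that are logarithmic along `H`. -/
theorem mem_logDer_iff_deletion {A : Finset (Submodule K V)} {H : Submodule K V} (hH : H ∈ A)
    {a : Module.Dual K V} (ha : H = LinearMap.ker a) {θ : Der K V} :
    θ ∈ logDer A ↔ θ ∈ logDer (deletion A H) ∧ form a ∣ θ (form a) := by
  constructor
  · intro h
    exact ⟨mem_logDer.2 fun L hL => mem_logDer.1 h L (mem_deletion.1 hL).2,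
      mem_logDer.1 h H hH a ha⟩
  · rintro ⟨h1, h2⟩
    refine mem_logDer.2 fun L hL b hb => ?_
    by_cases hLH : L = H
    · exact dvd_der_of_ker_eq (ha.symm.trans (hLH.symm.trans hb)) h2
    · exact mem_logDer.1 h1 L (mem_deletion.2 ⟨hLH, hL⟩) b hb

theorem exists_smul_eq_of_dvd {z : CoordRing K V} (hz : z ≠ 0) {θ : Der K V}
    (h : ∀ b, z ∣ θ (form b)) : ∃ η : Der K V, θ = z • η := by
  choose y hy using h
  obtain ⟨η, hη⟩ := exists_der (K := K) (V := V)
    { toFun := y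
      map_add' := fun b b' => mul_left_cancel₀ hz (by
        rw [← hy, mul_add, ← hy, ← hy, map_add, map_add])
      map_smul' := fun c b => mul_left_cancel₀ hz (by
        rw [← hy, RingHom.id_apply, mul_smul_comm, ← hy, map_smul, Derivation.map_smul]) }
  refine ⟨η, der_ext fun b => ?_⟩
  rw [hy b, Derivation.smul_apply, hη, smul_eq_mul]
  rfl

/-- A derivation `θ` restricted to `H`, as a function of linear forms on `V`. -/
noncomputable def resDer (H : Submodule K V) (θ : Der K V) (b : Module.Dual K V) :
    CoordRing K H :=
  res H (θ (form b))

variable {ι : Type*} [Fintype ι]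

/-- Combinations of the restrictions to `H` of given derivations. -/
noncomputable abbrev resCombo (H : Submodule K V) (θ : ι → Der K V) :
    (ι → CoordRing K H) →ₗ[K] (Module.Dual K V → CoordRing K H) :=
  combo K fun k => resDer H (θ k)

theorem resCombo_apply (H : Submodule K V) (θ : ι → Der K V) (c : ι → CoordRing K H)
    (b : Module.Dual K V) :
    resCombo H θ c b = ∑ k, c k * res H (θ k (form b)) := by
  rw [combo_apply, Finset.sum_apply]
  rfl

theorem resCombo_res (H : Submodule K V) (θ : ι → Der K V) (c : ι → CoordRing K V) :
    resCombo H θ (fun k => res H (c k)) = resDer H (combo K θ c) := by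
  funext b
  rw [resCombo_apply, resDer, combo_der_apply, map_sum]
  simp only [map_mul]

theorem combo_smul {W : Type*} [AddCommGroup W] [Module K W] {M : Type*} [AddCommGroup M]
    [Module (CoordRing K W) M] [Module K M] [IsScalarTower K (CoordRing K W) M] (g : ι → M)
    (z : CoordRing K W) (c : ι → CoordRing K W) : combo K g (z • c) = z • combo K g c :=
  (Fintype.linearCombination (CoordRing K W) g).map_smul z c

variable {A : Finset (Submodule K V)} {H : Submodule K V} {a : Module.Dual K V}

/-- A basis of `D(A ∖ {H})` stays linearly independent after restriction to `H`: if
`∑ c k • θ k = α_H • η`, then `η` is again in `D(A ∖ {H})`. -/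
theorem resCombo_injective (hA : IsArrangement A) (ha0 : a ≠ 0) (ha : H = LinearMap.ker a)
    {θ : ι → Der K V} (hgen : ∀ η ∈ logDer (deletion A H), ∃ c : ι → CoordRing K V, combo K θ c = η)
    (hmem : ∀ c : ι → CoordRing K V, combo K θ c ∈ logDer (deletion A H))
    (hind : Function.Injective (combo (W := V) K θ)) :
    Function.Injective (resCombo H θ) := by
  refine (injective_iff_map_eq_zero _).2 fun c hc => ?_
  choose y hy using fun k => res_surjective H (c k)
  have hc' : c = fun k => res H (y k) := funext fun k => (hy k).symm
  rw [hc', resCombo_res] at hc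
  obtain ⟨η, hη⟩ := exists_smul_eq_of_dvd (form_ne_zero ha0) (θ := combo K θ y) fun b =>
    (res_eq_zero_iff ha).1 (congrFun hc b)
  have hηA : η ∈ logDer (deletion A H) := by
    refine mem_logDer.2 fun L hL b hb => ?_
    obtain ⟨hLH, hLA⟩ := mem_deletion.1 hL
    have hb0 : b ≠ 0 := by
      rintro rfl
      obtain ⟨b', hb', h⟩ := hA L hLA
      rw [hb, LinearMap.ker_zero] at h
      exact hb' (LinearMap.ker_eq_top.1 h.symm)
    have h1 := mem_logDer.1 (hmem y) L hL b hb
    rw [hη, Derivation.smul_apply, smul_eq_mul] at h1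
    refine ((prime_form hb0).dvd_or_dvd h1).resolve_left fun h2 => hLH ?_
    rw [hb, ha]
    exact ker_eq_of_ker_le ha0 (ker_le_of_form_dvd_form h2)
  obtain ⟨z, rfl⟩ := hgen η hηA
  rw [← combo_smul] at hη
  have h3 := hind hη
  rw [hc', h3]
  funext k
  rw [Pi.smul_apply, smul_eq_mul, map_mul, (res_eq_zero_iff ha).2 dvd_rfl, zero_mul]
  rfl

/-- A syzygy of the polynomials `θ k (α_H)` on `H` defines a logarithmic derivation of the
restriction. -/
theorem exists_der_of_syzygy (hA : IsArrangement A) (ha : H = LinearMap.ker a)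
    {θ : ι → Der K V} (hmem : ∀ k, θ k ∈ logDer (deletion A H)) {c : ι → CoordRing K H}
    (hc : ∑ k, c k * res H (θ k (form a)) = 0) :
    ∃ ψ ∈ logDer (restriction A H), ∀ b,
      ψ (form (H.dualRestrict b)) = resCombo H θ c b := by
  let T : Module.Dual K V →ₗ[K] CoordRing K H :=
    ∑ k, LinearMap.mulLeft K (c k) ∘ₗ (res H).toLinearMap ∘ₗ (θ k).toLinearMap ∘ₗ form
  have hT : ∀ b, T b = resCombo H θ c b := by
    intro b
    rw [resCombo_apply]
    simp [T]
  obtain ⟨s, hs⟩ := H.dualRestrict.exists_rightInverse_of_surjective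
    (LinearMap.range_eq_top.2 Subspace.dualRestrict_surjective)
  obtain ⟨ψ, hψ⟩ := exists_der (T ∘ₗ s)
  have hψT : ∀ b, ψ (form (H.dualRestrict b)) = T b := by
    intro b
    rw [hψ, LinearMap.comp_apply, ← sub_eq_zero, ← map_sub]
    have h1 : H.dualRestrict (s (H.dualRestrict b) - b) = 0 := by
      rw [map_sub, sub_eq_zero]
      exact LinearMap.congr_fun hs _
    obtain ⟨r, hr⟩ := exists_smul_of_ker_le (ha.ge.trans (dualRestrict_eq_zero_iff.1 h1))
    rw [hr, map_smul, hT, resCombo_apply, hc, smul_zero]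
  refine ⟨ψ, mem_logDer.2 fun X hX β hβ => ?_, fun b => (hψT b).trans (hT b)⟩
  obtain ⟨L, hL, rfl⟩ := mem_restriction.1 hX
  obtain ⟨b, hb0, hb⟩ := hA L (mem_deletion.1 hL).2
  refine dvd_der_of_ker_eq (b := H.dualRestrict b) ?_ ?_
  · rw [ker_dualRestrict, ← hb, hβ]
  · rw [hψT, hT, resCombo_apply, ← res_form]
    exact Finset.dvd_sum fun k _ =>
      dvd_mul_of_dvd_right (map_dvd _ (mem_logDer.1 (hmem k) L hL b hb)) _

/-- In a unique factorization domain, a set closed under greatest common divisors has a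
smallest element for divisibility. -/
theorem exists_dvd_all {R : Type*} [CommRing R] [IsDomain R] [UniqueFactorizationMonoid R]
    {Q : Set R} (hne : ∃ s ∈ Q, s ≠ 0)
    (hgcd : ∀ s ∈ Q, ∀ s' ∈ Q, s ≠ 0 → ∃ g ∈ Q, g ≠ 0 ∧ g ∣ s ∧ g ∣ s') :
    ∃ g ∈ Q, ∀ s ∈ Q, g ∣ s := by
  obtain ⟨s, hs, hs0⟩ := hne
  obtain ⟨g, ⟨hg, hg0⟩, hmin⟩ := (wellFounded_dvdNotUnit (α := R)).has_min
    {s | s ∈ Q ∧ s ≠ 0} ⟨s, hs, hs0⟩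
  refine ⟨g, hg, fun s' hs' => ?_⟩
  obtain ⟨g', hg', hg'0, ⟨x, hx⟩, h2⟩ := hgcd g hg s' hs' hg0
  have hxu : IsUnit x := by
    by_contra hxu
    exact hmin g' ⟨hg', hg'0⟩ ⟨hg'0, x, hxu, hx⟩
  rw [hx]
  exact hxu.mul_right_dvd.2 h2

/-- Free surjection theorem: if `D(A ∖ {H})` has the basis `θ k`, then every logarithmic derivation
of the restriction `A^H` is a combination of the restrictions of the `θ k`. The denominators `s`
needed to write `s ψ` in this way are closed under greatest common divisors, because the restricted
`θ k` are independent; near the hyperplane `X` of `A^H`, a lift of `ψ` that is logarithmic along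
all `L` containing `X` shows that `α_X` is not needed as a factor of the denominator. -/
theorem exists_resCombo_eq [FiniteDimensional K V] (hA : IsArrangement A) (ha0 : a ≠ 0)
    (ha : H = LinearMap.ker a)
    {θ : ι → Der K V} (hgen : ∀ η ∈ logDer (deletion A H), ∃ c : ι → CoordRing K V, combo K θ c = η)
    (hmem : ∀ c : ι → CoordRing K V, combo K θ c ∈ logDer (deletion A H))
    (hind : Function.Injective (combo (W := V) K θ)) {ψ : Der K H}
    (hψ : ψ ∈ logDer (restriction A H)) :
    ∃ c, ∀ b, resCombo H θ c b = ψ (form (H.dualRestrict b)) := by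
  classical
  have hinj := resCombo_injective hA ha0 ha hgen hmem hind
  obtain ⟨α, hα⟩ := exists_forms hA
  obtain ⟨σ, hσ, -⟩ := exists_section_res H
  let T : Module.Dual K V →ₗ[K] CoordRing K H := ψ.toLinearMap ∘ₗ form ∘ₗ H.dualRestrict
  have hTa : T a = 0 := by
    have : H.dualRestrict a = 0 := dualRestrict_eq_zero_iff.2 ha.le
    simp [T, this]
  let Q : Set (CoordRing K H) :=
    {s | ∃ c, ∀ b, resCombo H θ c b = s * T b}
  have hgcd : ∀ s ∈ Q, ∀ s' ∈ Q, s ≠ 0 → ∃ g ∈ Q, g ≠ 0 ∧ g ∣ s ∧ g ∣ s' := by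
    rintro s ⟨c, hc⟩ s' ⟨c', hc'⟩ hs0
    obtain ⟨u, v, g, huv, rfl, rfl⟩ := UniqueFactorizationMonoid.exists_reduced_factors s hs0 s'
    have hg0 : g ≠ 0 := left_ne_zero_of_mul hs0
    have hu0 : u ≠ 0 := right_ne_zero_of_mul hs0
    have h1 : v • c = u • c' := by
      refine hinj (funext fun b => mul_left_cancel₀ hg0 ?_)
      rw [combo_smul, combo_smul, Pi.smul_apply, Pi.smul_apply, hc, hc', smul_eq_mul, smul_eq_mul]
      ring
    have h2 : ∀ k, u ∣ c k := fun k =>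
      huv.dvd_of_dvd_mul_left ⟨c' k, congrFun h1 k⟩
    choose z hz using h2
    have hcz : c = u • z := funext hz
    refine ⟨g, ⟨z, fun b => mul_left_cancel₀ hu0 ?_⟩, hg0, dvd_mul_right _ _, dvd_mul_right _ _⟩
    have h3 := hc b
    rw [hcz, combo_smul, Pi.smul_apply, smul_eq_mul] at h3
    rw [h3]
    ring
  -- a lift of `ψ` contributes every denominator that makes it logarithmic
  have hlift : ∀ (f : Module.Dual K V →ₗ[K] CoordRing K V) (q : CoordRing K V),
      (∀ b, res H (f b) = T b) → (∀ L ∈ deletion A H, form (α L) ∣ q * f (α L)) →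
      res H q ∈ Q := by
    intro f q hf hq
    obtain ⟨η, hη⟩ := exists_der f
    have h1 : q • η ∈ logDer (deletion A H) := by
      refine mem_logDer_of_forms (α := α) (fun L hL => (hα L (mem_deletion.1 hL).2).2)
        fun L hL => ?_
      rw [Derivation.smul_apply, smul_eq_mul, hη]
      exact hq L hL
    obtain ⟨c, hc⟩ := hgen _ h1
    refine ⟨fun k => res H (c k), fun b => ?_⟩
    rw [resCombo_res, hc, resDer, Derivation.smul_apply, smul_eq_mul, map_mul, hη, hf]
  have hαH : ∀ L ∈ deletion A H, H.dualRestrict (α L) ≠ 0 := by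
    intro L hL h0
    obtain ⟨hLH, hLA⟩ := mem_deletion.1 hL
    rw [dualRestrict_eq_zero_iff, ha] at h0
    apply hLH
    rw [(hα L hLA).2, ha]
    exact (ker_eq_of_ker_le (hα L hLA).1 h0).symm
  have hall : res H (∏ L ∈ deletion A H, form (α L)) ∈ Q := by
    refine hlift (σ.toLinearMap ∘ₗ T) _ (fun b => hσ _) fun L hL => ?_
    exact dvd_mul_of_dvd_left (Finset.dvd_prod_of_mem (fun L => form (α L)) hL) _
  have hloc : ∀ L₀ ∈ deletion A H, res H (∏ L ∈ (deletion A H).filter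
      (fun L => Submodule.comap H.subtype L ≠ Submodule.comap H.subtype L₀), form (α L)) ∈ Q := by
    intro L₀ hL₀
    obtain ⟨hL₀H, hL₀A⟩ := mem_deletion.1 hL₀
    obtain ⟨hα0, hαk⟩ := hα L₀ hL₀A
    obtain ⟨v, hv, hva⟩ : ∃ v, α L₀ v = 0 ∧ a v = 1 := by
      obtain ⟨v, hv, hva⟩ := SetLike.not_le_iff_exists.1 fun h : LinearMap.ker (α L₀) ≤
        LinearMap.ker a => hL₀H (by rw [hαk, ha]; exact ker_eq_of_ker_le ha0 h)
      refine ⟨(a v)⁻¹ • v, ?_, ?_⟩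
      · rw [map_smul, LinearMap.mem_ker.1 hv, smul_zero]
      · rw [map_smul, smul_eq_mul, inv_mul_cancel₀ hva]
    obtain ⟨w, hw, hwα⟩ : ∃ w, a w = 0 ∧ α L₀ w = 1 := by
      obtain ⟨w, hw, hwα⟩ := SetLike.not_le_iff_exists.1 fun h : LinearMap.ker a ≤
        LinearMap.ker (α L₀) => hL₀H (by rw [hαk, ha]; exact (ker_eq_of_ker_le hα0 h).symm)
      refine ⟨(α L₀ w)⁻¹ • w, ?_, ?_⟩
      · rw [map_smul, LinearMap.mem_ker.1 hw, smul_zero]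
      · rw [map_smul, smul_eq_mul, inv_mul_cancel₀ hwα]
    obtain ⟨g, hg⟩ : form (H.dualRestrict (α L₀)) ∣ T (α L₀) := by
      refine mem_logDer.1 hψ _ (mem_restriction.2 ⟨L₀, hL₀, rfl⟩) _ ?_
      rw [ker_dualRestrict, ← hαk]
    -- the lift of `ψ` sending both `α_H` and `α L₀` to their multiples by the same lift of `g`
    let f : Module.Dual K V →ₗ[K] CoordRing K V := σ.toLinearMap ∘ₗ T +
      (Module.Dual.eval K V v).smulRight (σ g * form a) +
      (Module.Dual.eval K V w).smulRight (σ g * form (α L₀) - σ (T (α L₀)))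
    have hf : ∀ b, f b = σ (T b) + b v • (σ g * form a) +
        b w • (σ g * form (α L₀) - σ (T (α L₀))) := fun b => rfl
    have hfa : f a = σ g * form a := by
      rw [hf, hTa, hva, hw, map_zero]
      simp
    have hfα : f (α L₀) = σ g * form (α L₀) := by
      rw [hf, hv, hwα]
      simp
    refine hlift f _ (fun b => ?_) fun L hL => ?_
    · rw [hf, map_add, map_add, map_smul, map_smul, map_sub, map_mul, map_mul, hσ, hσ, hσ,
        (res_eq_zero_iff ha).2 dvd_rfl, hg, res_form]
      rw [mul_comm g (form _)]
      simp
    · by_cases hX : Submodule.comap H.subtype L = Submodule.comap H.subtype L₀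
      · refine dvd_mul_of_dvd_right ?_ _
        have hLk := (hα L (mem_deletion.1 hL).2).2
        obtain ⟨r, hr⟩ : ∃ r : K, H.dualRestrict (α L) = r • H.dualRestrict (α L₀) := by
          refine exists_smul_of_ker_le (le_of_eq ?_)
          rw [ker_dualRestrict, ker_dualRestrict, ← hαk, ← hLk, hX]
        rw [← map_smul, ← sub_eq_zero, ← map_sub, dualRestrict_eq_zero_iff, ha] at hr
        obtain ⟨r', hr'⟩ := exists_smul_of_ker_le hr
        rw [sub_eq_iff_eq_add] at hr'
        refine ⟨σ g, ?_⟩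
        rw [hr', map_add, map_smul, map_smul, hfa, hfα, map_add, map_smul, map_smul, add_mul,
          smul_mul_assoc, smul_mul_assoc, mul_comm (form a), mul_comm (form (α L₀))]
      · exact dvd_mul_of_dvd_left (Finset.dvd_prod_of_mem (fun L => form (α L))
          (Finset.mem_filter.2 ⟨hL, hX⟩)) _
  have hne : ∃ s ∈ Q, s ≠ 0 := by
    refine ⟨_, hall, ?_⟩
    rw [map_prod]
    refine Finset.prod_ne_zero_iff.2 fun L hL => ?_
    rw [res_form]
    exact form_ne_zero (hαH L hL)
  obtain ⟨g, ⟨c, hc⟩, hdvd⟩ := exists_dvd_all hne hgcd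
  have hg : IsUnit g := by
    by_contra hg
    have hg0 : g ≠ 0 := by
      rintro rfl
      obtain ⟨s, hs, hs0⟩ := hne
      exact hs0 (zero_dvd_iff.1 (hdvd s hs))
    obtain ⟨p, hp, hpg⟩ := WfDvdMonoid.exists_irreducible_factor hg hg0
    have hpp := UniqueFactorizationMonoid.irreducible_iff_prime.1 hp
    have key : ∀ s : Finset (Submodule K V), s ⊆ deletion A H →
        res H (∏ L ∈ s, form (α L)) ∈ Q →
        ∃ L ∈ s, p ∣ form (H.dualRestrict (α L)) := by
      intro s _ hs
      have h1 := hpg.trans (hdvd _ hs)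
      rw [map_prod] at h1
      obtain ⟨L, hL, h2⟩ := (Prime.dvd_finsetProd_iff hpp _).1 h1
      exact ⟨L, hL, by rwa [res_form] at h2⟩
    obtain ⟨L₀, hL₀, hp0⟩ := key _ subset_rfl hall
    obtain ⟨L, hL, hpL⟩ := key _ (Finset.filter_subset _ _) (hloc L₀ hL₀)
    obtain ⟨hL, hne⟩ := Finset.mem_filter.1 hL
    have h3 := (hp.associated_of_dvd (prime_form (hαH L₀ hL₀)).irreducible hp0).symm.dvd.trans hpL
    have h4 := ker_eq_of_ker_le (hαH L hL) (ker_le_of_form_dvd_form h3)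
    rw [ker_dualRestrict, ker_dualRestrict, ← (hα L (mem_deletion.1 hL).2).2,
      ← (hα L₀ (mem_deletion.1 hL₀).2).2] at h4
    exact hne h4.symm
  obtain ⟨z, hz⟩ := hg.exists_left_inv
  refine ⟨z • c, fun b => ?_⟩
  rw [combo_smul, Pi.smul_apply, hc, smul_eq_mul, ← mul_assoc, hz, one_mul]
  rfl

end Log

/-! ### The syzygies on a hyperplane -/

section Syzygies

variable {K V : Type*} [Field K] [AddCommGroup V] [Module K V] {ι : Type*} [Fintype ι]
  {A : Finset (Submodule K V)} {H : Submodule K V} {a : Module.Dual K V}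
  {θ : ι → Der K V} {e : ι → ℕ}

/-- The degree `t` part of the syzygies of the polynomials `θ k (α_H)` on `H`. -/
noncomputable def syzPart (H : Submodule K V) (a : Module.Dual K V) (θ : ι → Der K V)
    (e : ι → ℕ) (t : ℕ) : Submodule K (ι → CoordRing K H) :=
  homogTuple K H e t ⊓ LinearMap.ker (combo K fun k => res H (θ k (form a)))

theorem mem_syzPart {t : ℕ} {c : ι → CoordRing K H} : c ∈ syzPart H a θ e t ↔
    c ∈ homogTuple K H e t ∧ ∑ k, c k * res H (θ k (form a)) = 0 := by
  rw [syzPart, Submodule.mem_inf, LinearMap.mem_ker, combo_apply]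
  rfl

theorem resCombo_mem_homogPart (hθ : ∀ k, IsHomogDer (e k) (θ k)) {t : ℕ}
    {c : ι → CoordRing K H} (hc : c ∈ homogTuple K H e t) (b : Module.Dual K V) :
    resCombo H θ c b ∈ homogPart K H t := by
  rw [resCombo_apply]
  exact Submodule.sum_mem _ fun k _ => shiftedPart_mul (mem_homogTuple.1 hc k)
    (map_mem_homogPart (res_form_mem H) (hθ k b))

theorem mem_homogTuple_of_resCombo (hθ : ∀ k, IsHomogDer (e k) (θ k))
    (hinj : Function.Injective (resCombo H θ)) {t : ℕ} {c : ι → CoordRing K H}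
    (hc : ∀ b, resCombo H θ c b ∈ homogPart K H t) : c ∈ homogTuple K H e t := by
  have h1 : (fun k => shiftComponent K H (e k) t (c k)) = c := by
    refine hinj (funext fun b => ?_)
    have h2 := component_of_mem (hc b) t
    rw [if_pos rfl] at h2
    rw [← h2, resCombo_apply, resCombo_apply, map_sum]
    exact Finset.sum_congr rfl fun k _ =>
      (component_mul (map_mem_homogPart (res_form_mem H) (hθ k b)) t (c k)).symm
  rw [← h1]
  exact mem_homogTuple.2 fun k => shiftComponent_mem _ _ _

theorem exists_dualRestrict_eq (β : Module.Dual K H) : ∃ b, H.dualRestrict b = β :=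
  Subspace.dualRestrict_surjective β

/-- If derivations `ψ p` on `H` are combinations of the restricted `θ k` with coefficient vectors
`ν p`, then a combination of the `ψ p` has the corresponding combination of the `ν p` as
coefficient vector. -/
theorem combo_apply_dualRestrict {κ : Type*} [Fintype κ] {ψ : κ → Der K H}
    {ν : κ → ι → CoordRing K H}
    (h : ∀ p b, resCombo H θ (ν p) b = ψ p (form (H.dualRestrict b)))
    (z : κ → CoordRing K H) (b : Module.Dual K V) :
    combo K ψ z (form (H.dualRestrict b)) = resCombo H θ (combo K ν z) b := by
  have h1 : resCombo H θ (combo K ν z) = ∑ p, z p • resCombo H θ (ν p) := by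
    rw [combo_apply ν z, map_sum]
    exact Finset.sum_congr rfl fun p _ => combo_smul _ _ _
  rw [h1, combo_der_apply, Finset.sum_apply]
  exact Finset.sum_congr rfl fun p _ => by rw [Pi.smul_apply, h, smul_eq_mul]

theorem combo_mem {κ : Type*} [Fintype κ] {M : Submodule (CoordRing K V) (Der K V)}
    {g : κ → Der K V} (hg : ∀ k, g k ∈ M) (c : κ → CoordRing K V) : combo K g c ∈ M := by
  rw [combo_apply]
  exact Submodule.sum_mem _ fun k _ => M.smul_mem _ (hg k)

theorem combo_basis_eq {κ : Type*} [Fintype κ] {M : Submodule (CoordRing K V) (Der K V)}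
    (b : Module.Basis κ (CoordRing K V) M) (c : κ → CoordRing K V) :
    combo K (fun k => (b k : Der K V)) c = (b.equivFun.symm c : M) := by
  rw [combo_apply, Module.Basis.equivFun_symm_apply]
  simp

theorem combo_basis_injective {κ : Type*} [Fintype κ] {M : Submodule (CoordRing K V) (Der K V)}
    (b : Module.Basis κ (CoordRing K V) M) :
    Function.Injective (combo (W := V) K fun k => (b k : Der K V)) := by
  intro c c' h
  rw [combo_basis_eq, combo_basis_eq] at h
  exact b.equivFun.symm.injective (Subtype.ext h)

theorem exists_combo_basis_eq {κ : Type*} [Fintype κ] {M : Submodule (CoordRing K V) (Der K V)}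
    (b : Module.Basis κ (CoordRing K V) M) {η : Der K V} (hη : η ∈ M) :
    ∃ c : κ → CoordRing K V, combo K (fun k => (b k : Der K V)) c = η := by
  refine ⟨b.equivFun ⟨η, hη⟩, ?_⟩
  rw [combo_basis_eq, LinearEquiv.symm_apply_apply]

theorem exists_basis_of_combo {κ : Type*} [Fintype κ] {M : Submodule (CoordRing K V) (Der K V)}
    {g : κ → Der K V} (hg : ∀ k, g k ∈ M) (hind : Function.Injective (combo (W := V) K g))
    (hgen : ∀ η ∈ M, ∃ c : κ → CoordRing K V, combo K g c = η) :
    ∃ b : Module.Basis κ (CoordRing K V) M, ∀ k, (b k : Der K V) = g k := by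
  have hli : LinearIndependent (CoordRing K V) (fun k => (⟨g k, hg k⟩ : M)) := by
    refine Fintype.linearIndependent_iff.2 fun c hc => ?_
    have h1 : combo K g c = 0 := by
      have := congrArg (fun x : M => (x : Der K V)) hc
      simpa [combo_apply] using this
    exact fun k => congrFun ((injective_iff_map_eq_zero _).1 hind c h1) k
  have hsp : ⊤ ≤ Submodule.span (CoordRing K V) (Set.range fun k => (⟨g k, hg k⟩ : M)) := by
    rintro ⟨η, hη⟩ -
    obtain ⟨c, rfl⟩ := hgen η hη
    refine (Submodule.mem_span_range_iff_exists_fun _).2 ⟨c, Subtype.ext ?_⟩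
    simp [combo_apply]
  exact ⟨Module.Basis.mk hli hsp, fun k => by rw [Module.Basis.mk_apply]⟩

variable [FiniteDimensional K V]

/-- If the restriction is free, its exponents give the Hilbert function of the syzygies. -/
theorem finrank_syzPart_of_free (hA : IsArrangement A) (ha0 : a ≠ 0) (ha : H = LinearMap.ker a)
    (b : Module.Basis ι (CoordRing K V) (logDer (deletion A H)))
    (hb : ∀ k, IsHomogDer (e k) (b k : Der K V)) {κ : Type*} [Fintype κ] {E : κ → ℕ}
    (b' : Module.Basis κ (CoordRing K H) (logDer (restriction A H)))
    (hb' : ∀ k, IsHomogDer (E k) (b' k : Der K H)) (t : ℕ) :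
    Module.finrank K (syzPart H a (fun k => (b k : Der K V)) e t) = ∑ k, hilb K H (E k) t := by
  have hgen := fun η (hη : η ∈ logDer (deletion A H)) => exists_combo_basis_eq b hη
  have hmem := combo_mem (g := fun k => (b k : Der K V)) fun k => (b k).2
  have hind := combo_basis_injective b
  have hinj := resCombo_injective hA ha0 ha hgen hmem hind
  choose ν hν using fun p => exists_resCombo_eq hA ha0 ha hgen hmem hind (b' p).2
  have hcombo := combo_apply_dualRestrict hν
  have hνinj : Function.Injective (combo (W := H) K ν) := by
    intro z z' h
    refine combo_basis_injective b' (der_ext fun β => ?_)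
    obtain ⟨β, rfl⟩ := exists_dualRestrict_eq β
    rw [hcombo, hcombo, h]
  have heq : syzPart H a (fun k => (b k : Der K V)) e t = (homogTuple K H E t).map (combo K ν) := by
    ext c
    rw [mem_syzPart]
    constructor
    · rintro ⟨hc, hc0⟩
      obtain ⟨ψ, hψ, hψc⟩ := exists_der_of_syzygy hA ha (fun k => (b k).2) hc0
      obtain ⟨z, rfl⟩ := exists_combo_basis_eq b' hψ
      refine ⟨z, ?_, hinj (funext fun β => ?_)⟩
      · have hhom : IsHomogDer t (combo K (fun k => (b' k : Der K H)) z) := by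
          intro β
          obtain ⟨β, rfl⟩ := exists_dualRestrict_eq β
          rw [hψc]
          exact resCombo_mem_homogPart hb hc β
        rw [← combo_basis_injective b' (combo_shiftComponent hb' hhom)]
        exact mem_homogTuple.2 fun k => shiftComponent_mem _ _ _
      · rw [← hcombo, hψc]
    · rintro ⟨z, hz, rfl⟩
      constructor
      · refine mem_homogTuple_of_resCombo hb hinj fun β => ?_
        rw [← hcombo]
        exact isHomogDer_combo hb' hz _
      · rw [← resCombo_apply H (fun k => (b k : Der K V)), ← hcombo,
          dualRestrict_eq_zero_iff.2 ha.le, map_zero, map_zero]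
  rw [heq, finrank_map_of_injective hνinj, finrank_homogTuple]

/-- The degree `t` part of `D(A)`, written in the basis `θ k` of `D(A ∖ {H})`, maps onto the
syzygies on `H`, with kernel `α_H • D(A ∖ {H})`. -/
theorem finrank_syzPart_add (hH : H ∈ A) (ha0 : a ≠ 0)
    (ha : H = LinearMap.ker a)
    (b : Module.Basis ι (CoordRing K V) (logDer (deletion A H))) (e : ι → ℕ) (t : ℕ) :
    Module.finrank K (syzPart H a (fun k => (b k : Der K V)) e t) +
      ∑ k, hilb K V (e k + 1) t =
    Module.finrank K (homogTuple K V e t ⊓ ((logDer A).restrictScalars K).comap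
      (combo K fun k => (b k : Der K V)) : Submodule K _) := by
  have hmem := combo_mem (g := fun k => (b k : Der K V)) fun k => (b k).2
  let G : Submodule K (ι → CoordRing K V) := homogTuple K V e t ⊓
    ((logDer A).restrictScalars K).comap (combo K fun k => (b k : Der K V))
  have hG : ∀ c, c ∈ G ↔ c ∈ homogTuple K V e t ∧
      form a ∣ combo K (fun k => (b k : Der K V)) c (form a) := by
    intro c
    change _ ∧ combo K (fun k => (b k : Der K V)) c ∈ logDer A ↔ _
    rw [mem_logDer_iff_deletion hH ha]
    exact and_congr_right fun _ => and_iff_right (hmem c)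
  let ρ : (ι → CoordRing K V) →ₗ[K] (ι → CoordRing K H) :=
    LinearMap.pi fun k => (res H).toLinearMap ∘ₗ LinearMap.proj k
  let μ : (ι → CoordRing K V) →ₗ[K] (ι → CoordRing K V) :=
    LinearMap.pi fun k => LinearMap.mulLeft K (form a) ∘ₗ LinearMap.proj k
  have hμ : Function.Injective μ := fun c c' h => funext fun k =>
    mul_left_cancel₀ (form_ne_zero ha0) (congrFun h k)
  have hres : ∀ c, form a ∣ combo K (fun k => (b k : Der K V)) c (form a) ↔
      ∑ k, ρ c k * res H ((b k : Der K V) (form a)) = 0 := by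
    intro c
    rw [← res_eq_zero_iff ha, combo_der_apply, map_sum]
    simp only [map_mul]
    rfl
  have h1 : G.map ρ = syzPart H a (fun k => (b k : Der K V)) e t := by
    ext c
    rw [mem_syzPart]
    constructor
    · rintro ⟨y, hy, rfl⟩
      obtain ⟨hy1, hy2⟩ := (hG y).1 hy
      exact ⟨mem_homogTuple.2 fun k => map_mem_shiftedPart (res_form_mem H)
        (mem_homogTuple.1 hy1 k), (hres y).1 hy2⟩
    · rintro ⟨hc, hc0⟩
      choose y hy hyc using fun k => exists_res_eq (mem_homogTuple.1 hc k)
      obtain rfl : ρ y = c := funext hyc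
      exact ⟨y, (hG y).2 ⟨mem_homogTuple.2 hy, (hres y).2 hc0⟩, rfl⟩
  have h2 : G ⊓ LinearMap.ker ρ = (homogTuple K V (fun k => e k + 1) t).map μ := by
    ext c
    constructor
    · rintro ⟨hc, hc0⟩
      have h3 : ∀ k, form a ∣ c k := fun k => (res_eq_zero_iff ha).1 (congrFun hc0 k)
      choose y hy using h3
      refine ⟨y, mem_homogTuple.2 fun k => ?_, (funext hy).symm⟩
      have h4 := mem_homogTuple.1 ((hG c).1 hc).1 k
      rw [hy, mul_comm] at h4
      exact mem_shiftedPart_of_mul_mem (form_mem_homogPart a) (form_ne_zero ha0) h4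
    · rintro ⟨y, hy, rfl⟩
      have h0 : ρ (μ y) = 0 := funext fun k => (res_eq_zero_iff ha).2 (dvd_mul_right _ _)
      refine ⟨(hG _).2 ⟨mem_homogTuple.2 fun k => ?_, (hres _).2 ?_⟩, h0⟩
      · change form a * y k ∈ _
        refine shiftedPart_mul_shiftedPart (s := e k + 1) ?_ (mem_homogTuple.1 hy k)
        rw [shiftedPart_add]
        exact form_mem_homogPart a
      · rw [h0]
        simp
  have : FiniteDimensional K G := Submodule.finiteDimensional_of_le inf_le_left
  have h5 := finrank_map_add_finrank_inf_ker ρ G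
  rw [h1, h2, finrank_map_of_injective hμ, finrank_homogTuple] at h5
  exact h5

/-- The Hilbert function of a module with a resolution
`0 → S[-q] → ⨁ S[-p i] → M → 0`. -/
theorem finrank_map_combo_of_res {κ : Type*} [Fintype κ] {g : κ → Der K V} {p : κ → ℕ} {q : ℕ}
    {r : κ → CoordRing K V} (hr : ∀ i, r i ∈ shiftedPart K V (p i) q) (hr0 : r ≠ 0)
    (hker : ∀ c : κ → CoordRing K V, ∑ i, c i • g i = 0 ↔ ∃ z : CoordRing K V, z • r = c)
    (t : ℕ) :
    Module.finrank K ((homogTuple K V p t).map (combo K g)) + hilb K V q t =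
      ∑ i, hilb K V (p i) t := by
  obtain ⟨i, hi⟩ := Function.ne_iff.1 hr0
  let μ : CoordRing K V →ₗ[K] (κ → CoordRing K V) :=
    LinearMap.pi fun i => LinearMap.mulRight K (r i)
  have hμ : Function.Injective μ := fun z z' h => mul_right_cancel₀ hi (congrFun h i)
  have h1 : homogTuple K V p t ⊓ LinearMap.ker (combo K g) = (shiftedPart K V q t).map μ := by
    ext c
    constructor
    · rintro ⟨hc, hc0⟩
      obtain ⟨z, rfl⟩ := (hker c).1 hc0
      refine ⟨z, ?_, rfl⟩
      have h2 := hr i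
      have hpq : p i ≤ q := by
        by_contra hpq
        rw [shiftedPart_of_lt (not_le.1 hpq)] at h2
        exact hi h2
      obtain ⟨m, rfl⟩ := Nat.exists_eq_add_of_le hpq
      rw [shiftedPart_add] at h2
      exact mem_shiftedPart_of_mul_mem h2 hi (mem_homogTuple.1 hc i)
    · rintro ⟨z, hz, rfl⟩
      refine ⟨mem_homogTuple.2 fun k => ?_, (hker _).2 ⟨z, rfl⟩⟩
      change z * r k ∈ _
      rw [mul_comm]
      exact shiftedPart_mul_shiftedPart (hr k) hz
  rw [← finrank_homogTuple, hilb, ← finrank_map_of_injective hμ, ← h1]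
  exact finrank_map_add_finrank_inf_ker (combo K g) _

end Syzygies

/-! ### From two generators to bases and resolutions -/

section Generators

theorem sum_eq_add_pair {ι M : Type*} [Fintype ι] [DecidableEq ι] [AddCommMonoid M] {i j : ι}
    (hij : i ≠ j) (F : ι → M) :
    ∑ k, F k = F i + (F j + ∑ l : {k // k ≠ i ∧ k ≠ j}, F l) := by
  rw [← Finset.add_sum_erase _ _ (Finset.mem_univ i),
    ← Finset.add_sum_erase _ _ (Finset.mem_erase.2 ⟨hij.symm, Finset.mem_univ j⟩)]
  congr 2
  exact Finset.sum_subtype _ (by simp [and_comm]) _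

theorem exists_of_two_term_syzygy {R : Type*} [CommRing R] [IsDomain R]
    [UniqueFactorizationMonoid R] {u v x y f g : R} (hf : f ≠ 0) (hu : u ≠ 0)
    (huv : IsRelPrime u v) (hfg : v * f = u * g) (h : x * f + y * g = 0) :
    ∃ w, x = w * v ∧ y = -(w * u) := by
  have h1 : x * u = -(y * v) := mul_right_cancel₀ hf (by linear_combination u * h + y * hfg)
  obtain ⟨z, rfl⟩ : u ∣ y := by
    refine huv.dvd_of_dvd_mul_right ⟨-x, ?_⟩
    linear_combination h1
  exact ⟨-z, mul_right_cancel₀ hu (by linear_combination h1), by ring⟩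

variable {K V : Type*} [Field K] [AddCommGroup V] [Module K V] [FiniteDimensional K V]
  {ι : Type*} [Fintype ι] [DecidableEq ι]
  {A : Finset (Submodule K V)} {H : Submodule K V} {a : Module.Dual K V}
  {e : ι → ℕ} {i j : ι} {D : ℕ} {u v : CoordRing K H} {P Q : ι → CoordRing K H}

/-- If the polynomials `θ k (α_H)` on `H` are combinations of two of them, of indices `i` and `j`,
with a coprime syzygy of degree `D`, then `D(A^H)` has a basis with one element of degree `e k` for
each `k ≠ i, j` and one of degree `D`. -/
theorem exists_basis_restriction (hA : IsArrangement A) (ha0 : a ≠ 0) (ha : H = LinearMap.ker a)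
    (b : Module.Basis ι (CoordRing K V) (logDer (deletion A H)))
    (hb : ∀ k, IsHomogDer (e k) (b k : Der K V)) (hij : i ≠ j)
    (hi0 : res H ((b i : Der K V) (form a)) ≠ 0) (hu0 : u ≠ 0) (hv0 : v ≠ 0)
    (hu : u ∈ shiftedPart K H (e j) D) (hv : v ∈ shiftedPart K H (e i) D) (huv : IsRelPrime u v)
    (huvf : v * res H ((b i : Der K V) (form a)) = u * res H ((b j : Der K V) (form a)))
    (hP : ∀ k, P k ∈ shiftedPart K H (e i) (e k)) (hQ : ∀ k, Q k ∈ shiftedPart K H (e j) (e k))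
    (hPQ : ∀ k, res H ((b k : Der K V) (form a)) =
      P k * res H ((b i : Der K V) (form a)) + Q k * res H ((b j : Der K V) (form a))) :
    ∃ b' : Module.Basis (Option {k // k ≠ i ∧ k ≠ j}) (CoordRing K H) (logDer (restriction A H)),
      ∀ l, IsHomogDer (l.elim D fun k => e k) (b' l : Der K H) := by
  have hgen := fun η (hη : η ∈ logDer (deletion A H)) => exists_combo_basis_eq b hη
  have hmem := combo_mem (g := fun k => (b k : Der K V)) fun k => (b k).2
  have hind := combo_basis_injective b
  have hinj := resCombo_injective hA ha0 ha hgen hmem hind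
  set f : ι → CoordRing K H := fun k => res H ((b k : Der K V) (form a)) with hf
  -- the syzygies expressing `f k` by `f i` and `f j`, and the syzygy between `f i` and `f j`
  let ν : Option {k // k ≠ i ∧ k ≠ j} → ι → CoordRing K H := fun l =>
    l.elim (Pi.single i v - Pi.single j u)
      fun k => Pi.single (k : ι) 1 - Pi.single i (P k) - Pi.single j (Q k)
  have hνdeg : ∀ l, ν l ∈ homogTuple K H e (l.elim D fun k => e k) := by
    rintro (_ | k)
    · exact sub_mem (single_mem_homogTuple hv) (single_mem_homogTuple hu)
    · exact sub_mem (sub_mem (single_mem_homogTuple (one_mem_shiftedPart _))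
        (single_mem_homogTuple (hP k))) (single_mem_homogTuple (hQ k))
  have hνf : ∀ l, combo K f (ν l) = 0 := by
    rintro (_ | k)
    · change combo K f (Pi.single i v - Pi.single j u) = 0
      rw [map_sub, combo_single, combo_single, smul_eq_mul, smul_eq_mul, sub_eq_zero]
      exact huvf
    · change combo K f (Pi.single (k : ι) 1 - Pi.single i (P k) - Pi.single j (Q k)) = 0
      rw [map_sub, map_sub, combo_single, combo_single, combo_single, one_smul, smul_eq_mul,
        smul_eq_mul, sub_sub, sub_eq_zero]
      exact hPQ k
  have hcoord : ∀ (z : Option {k // k ≠ i ∧ k ≠ j} → CoordRing K H) (m : ι),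
      combo K ν z m = z none * ν none m + ∑ k, z (some k) * ν (some k) m := by
    intro z m
    rw [combo_apply, Finset.sum_apply, Fintype.sum_option]
    rfl
  have hrest : ∀ (z : Option {k // k ≠ i ∧ k ≠ j} → CoordRing K H) (m : {k // k ≠ i ∧ k ≠ j}),
      combo K ν z m = z (some m) := by
    intro z m
    rw [hcoord, Finset.sum_eq_single m]
    · simp [ν, m.2.1, m.2.2]
    · intro k _ hk
      have : (m : ι) ≠ k := fun h => hk (Subtype.ext h.symm)
      simp [ν, m.2.1, m.2.2, this]
    · simp
  have hνinj : ∀ z : Option {k // k ≠ i ∧ k ≠ j} → CoordRing K H, combo K ν z = 0 → z = 0 := by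
    intro z hz
    have h1 : ∀ m, z (some m) = 0 := fun m =>
      (hrest z m).symm.trans (congrFun hz m)
    have h2 := congrFun hz i
    rw [hcoord] at h2
    simp only [h1, zero_mul, Finset.sum_const_zero, add_zero] at h2
    have h3 : ν none i = v := by simp [ν, hij]
    rw [h3] at h2
    funext l
    rcases l with _ | m
    · exact (mul_eq_zero.1 h2).resolve_right hv0
    · exact h1 m
  have hνgen : ∀ c, combo K f c = 0 →
      ∃ z : Option {k // k ≠ i ∧ k ≠ j} → CoordRing K H, combo K ν z = c := by
    intro c hc
    let z₀ : Option {k // k ≠ i ∧ k ≠ j} → CoordRing K H := fun l => l.elim 0 fun k => c k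
    have h1 : combo K f (c - combo K ν z₀) = 0 := by
      rw [map_sub, hc, zero_sub, neg_eq_zero, combo_apply ν, map_sum]
      refine Finset.sum_eq_zero fun l _ => ?_
      rw [combo_smul, hνf, smul_zero]
    have h2 : ∀ m : {k // k ≠ i ∧ k ≠ j}, (c - combo K ν z₀) m = 0 := by
      intro m
      rw [Pi.sub_apply, hrest]
      exact sub_self _
    have h3 := h1
    rw [combo_apply, sum_eq_add_pair hij] at h3
    simp only [h2, smul_eq_mul, zero_mul, Finset.sum_const_zero, add_zero] at h3
    obtain ⟨w, hwi, hwj⟩ := exists_of_two_term_syzygy hi0 hu0 huv huvf h3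
    refine ⟨z₀ + Pi.single none w, ?_⟩
    rw [map_add, combo_single, ← eq_sub_iff_add_eq']
    funext m
    rw [Pi.smul_apply, smul_eq_mul]
    by_cases hmi : m = i
    · subst hmi
      rw [hwi]
      simp [ν, hij]
    by_cases hmj : m = j
    · subst hmj
      rw [hwj]
      simp [ν, hij.symm]
    · rw [h2 ⟨m, hmi, hmj⟩]
      simp [ν, hmi, hmj]
  choose ψ hψ hψν using fun l => exists_der_of_syzygy hA ha (fun k => (b k).2)
    (c := ν l) (hνf l)
  have hcombo := combo_apply_dualRestrict (fun l β => (hψν l β).symm)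
  obtain ⟨b', hb'⟩ := exists_basis_of_combo hψ
    ((injective_iff_map_eq_zero _).2 fun z hz => hνinj z (hinj (funext fun β => by
      rw [← hcombo, hz, map_zero]
      rfl))) (fun η hη => by
      obtain ⟨c, hc⟩ := exists_resCombo_eq hA ha0 ha hgen hmem hind hη
      obtain ⟨z, rfl⟩ := hνgen c (by
        have := hc a
        rwa [dualRestrict_eq_zero_iff.2 ha.le, map_zero, map_zero, resCombo_apply] at this)
      refine ⟨z, der_ext fun β => ?_⟩
      obtain ⟨β, rfl⟩ := exists_dualRestrict_eq β
      rw [hcombo, hc])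
  refine ⟨b', fun l β => ?_⟩
  obtain ⟨β, rfl⟩ := exists_dualRestrict_eq β
  rw [hb', hψν]
  exact resCombo_mem_homogPart hb (hνdeg l) β

/-- If the polynomials `θ k (α_H)` on `H` are combinations of two of them, of indices `i` and `j`,
with a coprime syzygy `(v, -u)` of degree `D`, then `D(A)` is generated by `α_H θ i`, `α_H θ j`,
corrections of the other `θ k` and a lift `φ` of the syzygy; the only relation comes from writing
`α_H φ` by the first two generators. -/
theorem hasMinFreeRes_of_generators (hH : H ∈ A) (ha0 : a ≠ 0) (ha : H = LinearMap.ker a)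
    (b : Module.Basis ι (CoordRing K V) (logDer (deletion A H)))
    (hb : ∀ k, IsHomogDer (e k) (b k : Der K V)) (hij : i ≠ j) (hiD : e i < D) (hjD : e j < D)
    (hi0 : res H ((b i : Der K V) (form a)) ≠ 0) (hu0 : u ≠ 0) (hv0 : v ≠ 0)
    (hu : u ∈ shiftedPart K H (e j) D) (hv : v ∈ shiftedPart K H (e i) D) (huv : IsRelPrime u v)
    (huvf : v * res H ((b i : Der K V) (form a)) = u * res H ((b j : Der K V) (form a)))
    (hP : ∀ k, P k ∈ shiftedPart K H (e i) (e k)) (hQ : ∀ k, Q k ∈ shiftedPart K H (e j) (e k))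
    (hPQ : ∀ k, res H ((b k : Der K V) (form a)) =
      P k * res H ((b i : Der K V) (form a)) + Q k * res H ((b j : Der K V) (form a))) :
    HasMinFreeRes (logDer A)
      (Sum.elim (fun k => if k = i ∨ k = j then e k + 1 else e k) (fun _ : Unit => D))
      (fun _ : Unit => D + 1) := by
  have hji := hij.symm
  have hind := combo_basis_injective b
  set θ : ι → Der K V := fun k => (b k : Der K V) with hθ
  choose P' hP' hP'res using fun k => exists_res_eq (hP k)
  choose Q' hQ' hQ'res using fun k => exists_res_eq (hQ k)
  obtain ⟨u', hu', rfl⟩ := exists_res_eq hu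
  obtain ⟨v', hv', rfl⟩ := exists_res_eq hv
  have hmemA : ∀ η : Der K V, η ∈ logDer A ↔
      η ∈ logDer (deletion A H) ∧ res H (η (form a)) = 0 := by
    intro η
    rw [mem_logDer_iff_deletion hH ha, res_eq_zero_iff ha]
  have hθm : ∀ k, θ k ∈ logDer (deletion A H) := fun k => (b k).2
  have haz : res H (form a) = 0 := (res_eq_zero_iff ha).2 dvd_rfl
  have ha1 : ∀ t, form a ∈ shiftedPart K V t (t + 1) := fun t => by
    rw [shiftedPart_add]
    exact form_mem_homogPart a
  let g : ι ⊕ Unit → Der K V := Sum.elim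
    (fun k => if k = i ∨ k = j then form a • θ k else θ k - P' k • θ i - Q' k • θ j)
    (fun _ => v' • θ i - u' • θ j)
  let r : ι ⊕ Unit → CoordRing K V := Sum.elim
    (fun k => if k = i then -v' else if k = j then u' else 0) (fun _ => form a)
  have hgi : g (Sum.inl i) = form a • θ i := by simp [g]
  have hgj : g (Sum.inl j) = form a • θ j := by simp [g]
  have hgl : ∀ l : {k // k ≠ i ∧ k ≠ j}, g (Sum.inl l) = θ l - P' l • θ i - Q' l • θ j :=
    fun l => by simp [g, l.2.1, l.2.2]
  have hgD : g (Sum.inr ()) = v' • θ i - u' • θ j := rfl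
  -- combinations of the generators in terms of the basis
  have hsum : ∀ c : ι ⊕ Unit → CoordRing K V, ∑ p, c p • g p = combo K θ (fun k =>
      if k = i then form a * c (Sum.inl i) + c (Sum.inr ()) * v' -
        ∑ l : {k // k ≠ i ∧ k ≠ j}, c (Sum.inl l) * P' l
      else if k = j then form a * c (Sum.inl j) - c (Sum.inr ()) * u' -
        ∑ l : {k // k ≠ i ∧ k ≠ j}, c (Sum.inl l) * Q' l
      else c (Sum.inl k)) := by
    intro c
    rw [Fintype.sum_sum_type, sum_eq_add_pair hij, combo_apply, sum_eq_add_pair hij, hgi, hgj]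
    simp only [Finset.univ_unique, PUnit.default_eq_unit, Finset.sum_singleton, hgD, hgl, if_true,
      if_neg hji]
    have h1 : ∀ l : {k // k ≠ i ∧ k ≠ j}, c (Sum.inl l) • (θ l - P' l • θ i - Q' l • θ j) =
        c (Sum.inl l) • θ l - (c (Sum.inl l) * P' l) • θ i - (c (Sum.inl l) * Q' l) • θ j := by
      intro l
      module
    have h2 : ∀ l : {k // k ≠ i ∧ k ≠ j}, (if (l : ι) = i then form a * c (Sum.inl i) +
        c (Sum.inr ()) * v' - ∑ l : {k // k ≠ i ∧ k ≠ j}, c (Sum.inl l) * P' l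
        else if (l : ι) = j then form a * c (Sum.inl j) - c (Sum.inr ()) * u' -
        ∑ l : {k // k ≠ i ∧ k ≠ j}, c (Sum.inl l) * Q' l else c (Sum.inl l)) = c (Sum.inl l) :=
      fun l => by rw [if_neg l.2.1, if_neg l.2.2]
    simp only [h1, h2, Finset.sum_sub_distrib, ← Finset.sum_smul]
    module
  refine ⟨g, fun _ => r, ?_, ?_, ?_, ?_, ?_, ?_⟩
  · rintro (k | _)
    · simp only [Sum.elim_inl, g]
      split_ifs with h
      · exact isHomogDer_smul (hb k) (ha1 _)
      · exact isHomogDer_sub (isHomogDer_sub (hb k) (isHomogDer_smul (hb i) (hP' k)))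
          (isHomogDer_smul (hb j) (hQ' k))
    · exact isHomogDer_sub (isHomogDer_smul (hb i) hv') (isHomogDer_smul (hb j) hu')
  · rintro _ (k | _)
    · by_cases hki : k = i
      · subst hki
        simp only [r, Sum.elim_inl, if_true, true_or]
        rw [shiftedPart_succ_succ]
        exact neg_mem hv'
      by_cases hkj : k = j
      · subst hkj
        simp only [r, Sum.elim_inl, if_true, or_true, if_neg hki]
        rw [shiftedPart_succ_succ]
        exact hu'
      · simp only [r, Sum.elim_inl, if_neg hki, if_neg hkj]
        exact zero_mem _
    · exact ha1 D
  · have hpos : ∀ {s : ℕ} {x : CoordRing K V}, s < D → x ∈ shiftedPart K V s D →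
        x ∈ irrelevantIdeal K V := by
      intro s x hs hx
      rw [shiftedPart, if_pos hs.le] at hx
      exact homogPart_le_irrelevantIdeal (by omega) hx
    rintro _ (k | _)
    · simp only [r, Sum.elim_inl]
      split_ifs
      · exact neg_mem (hpos hiD hv')
      · exact hpos hjD hu'
      · exact zero_mem _
    · exact Ideal.subset_span ⟨a, rfl⟩
  · apply le_antisymm
    · rw [Submodule.span_le]
      rintro _ ⟨p | _, rfl⟩
      · refine (hmemA _).2 ?_
        by_cases hp : p = i ∨ p = j
        · simp only [g, Sum.elim_inl, if_pos hp]
          refine ⟨Submodule.smul_mem _ _ (hθm p), ?_⟩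
          rw [Derivation.smul_apply, smul_eq_mul, map_mul, haz, zero_mul]
        · simp only [g, Sum.elim_inl, if_neg hp]
          refine ⟨sub_mem (sub_mem (hθm p) (Submodule.smul_mem _ _ (hθm i)))
            (Submodule.smul_mem _ _ (hθm j)), ?_⟩
          simp only [Derivation.sub_apply, Derivation.smul_apply, smul_eq_mul, map_sub, map_mul,
            hP'res, hQ'res]
          linear_combination hPQ p
      · refine (hmemA _).2 ⟨sub_mem (Submodule.smul_mem _ _ (hθm i))
          (Submodule.smul_mem _ _ (hθm j)), ?_⟩
        rw [hgD, Derivation.sub_apply, Derivation.smul_apply, Derivation.smul_apply, smul_eq_mul,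
          smul_eq_mul, map_sub, map_mul, map_mul, sub_eq_zero]
        exact huvf
    · intro η hη
      obtain ⟨h1, h2⟩ := (hmemA η).1 hη
      obtain ⟨c, rfl⟩ := exists_combo_basis_eq b h1
      rw [combo_der_apply, map_sum, sum_eq_add_pair hij] at h2
      simp only [map_mul] at h2
      have h3 : (res H (c i) + ∑ l : {k // k ≠ i ∧ k ≠ j}, res H (c l) * P l) *
            res H (θ i (form a)) +
          (res H (c j) + ∑ l : {k // k ≠ i ∧ k ≠ j}, res H (c l) * Q l) *
            res H (θ j (form a)) = 0 := by
        rw [← h2, add_mul, add_mul, Finset.sum_mul, Finset.sum_mul]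
        have h4 : ∑ l : {k // k ≠ i ∧ k ≠ j}, res H (c l) * res H ((b l : Der K V) (form a)) =
            ∑ l : {k // k ≠ i ∧ k ≠ j}, res H (c l) * P l * res H (θ i (form a)) +
            ∑ l : {k // k ≠ i ∧ k ≠ j}, res H (c l) * Q l * res H (θ j (form a)) := by
          rw [← Finset.sum_add_distrib]
          refine Finset.sum_congr rfl fun l _ => ?_
          rw [hPQ l]
          ring
        rw [h4]
        ring
      obtain ⟨w, hwi, hwj⟩ := exists_of_two_term_syzygy hi0 hu0 huv huvf h3
      obtain ⟨w, rfl⟩ := res_surjective H w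
      obtain ⟨x, hx⟩ : form a ∣ c i + ∑ l : {k // k ≠ i ∧ k ≠ j}, c l * P' l - w * v' := by
        rw [← res_eq_zero_iff ha, map_sub, map_add, map_sum, map_mul]
        simp only [map_mul, hP'res]
        rw [hwi, sub_self]
      obtain ⟨y, hy⟩ : form a ∣ c j + ∑ l : {k // k ≠ i ∧ k ≠ j}, c l * Q' l + w * u' := by
        rw [← res_eq_zero_iff ha, map_add, map_add, map_sum, map_mul]
        simp only [map_mul, hQ'res]
        rw [hwj, neg_add_cancel]
      refine (Submodule.mem_span_range_iff_exists_fun _).2 ⟨Sum.elim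
        (fun k => if k = i then x else if k = j then y else c k) (fun _ => w), ?_⟩
      rw [hsum]
      congr 1
      funext k
      have hcl : ∀ l : {k // k ≠ i ∧ k ≠ j},
          (if (l : ι) = i then x else if (l : ι) = j then y else c l) = c l :=
        fun l => by rw [if_neg l.2.1, if_neg l.2.2]
      simp only [Sum.elim_inl, Sum.elim_inr, hcl, if_true, if_neg hji]
      by_cases hki : k = i
      · rw [if_pos hki, hki]
        linear_combination -hx
      by_cases hkj : k = j
      · rw [if_neg hki, if_pos hkj, hkj]
        linear_combination -hy
      · simp only [if_neg hki, if_neg hkj]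
  · refine Fintype.linearIndependent_iff.2 fun c hc p => ?_
    have h1 := congrFun hc (Sum.inr ())
    simp only [Finset.univ_unique, PUnit.default_eq_unit, Finset.sum_singleton, Pi.smul_apply,
      smul_eq_mul, Pi.zero_apply] at h1
    exact (mul_eq_zero.1 h1).resolve_right (form_ne_zero ha0)
  · intro c
    rw [Set.range_const, Submodule.mem_span_singleton, hsum, ← map_zero (combo (W := V) K θ),
      hind.eq_iff]
    constructor
    · intro h
      have hl : ∀ l : {k // k ≠ i ∧ k ≠ j}, c (Sum.inl l) = 0 := fun l => by
        have := congrFun h l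
        rwa [if_neg l.2.1, if_neg l.2.2] at this
      have hi' := congrFun h i
      have hj' := congrFun h j
      simp only [hl, zero_mul, Finset.sum_const_zero, sub_zero, if_true, if_neg hji,
        Pi.zero_apply] at hi' hj'
      obtain ⟨w, hw⟩ : form a ∣ c (Sum.inr ()) := by
        rw [← res_eq_zero_iff ha]
        have h1 := congrArg (res H) hi'
        rw [map_add, map_mul, map_mul, haz, zero_mul, zero_add, map_zero] at h1
        exact (mul_eq_zero.1 h1).resolve_right hv0
      have ha' := form_ne_zero ha0
      refine ⟨w, funext fun p => ?_⟩
      rw [Pi.smul_apply, smul_eq_mul]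
      rcases p with k | _
      · by_cases hki : k = i
        · subst hki
          simp only [r, Sum.elim_inl, if_true]
          refine mul_left_cancel₀ ha' ?_
          rw [hw] at hi'
          linear_combination -hi'
        by_cases hkj : k = j
        · subst hkj
          simp only [r, Sum.elim_inl, if_true, if_neg hki]
          refine mul_left_cancel₀ ha' ?_
          rw [hw] at hj'
          linear_combination -hj'
        · simp only [r, Sum.elim_inl, if_neg hki, if_neg hkj, mul_zero]
          exact (hl ⟨k, hki, hkj⟩).symm
      · rw [hw, mul_comm]
        rfl
    · rintro ⟨w, rfl⟩
      have hl : ∀ l : {k // k ≠ i ∧ k ≠ j}, (w • r) (Sum.inl l) = 0 := fun l => by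
        simp [r, l.2.1, l.2.2]
      funext k
      simp only [hl, zero_mul, Finset.sum_const_zero, sub_zero]
      by_cases hki : k = i
      · simp [r, hki]
        ring
      by_cases hkj : k = j
      · simp [r, hkj, hji]
        ring
      · simp [r, hki, hkj]

end Generators

/-! ### Exponents -/

theorem map_val_eq_sum_singleton {ι : Type*} (s : Finset ι) (f : ι → ℕ) :
    s.val.map f = ∑ k ∈ s, ({f k} : Multiset ℕ) := by
  rw [Finset.sum, ← Multiset.sum_map_singleton (s.val.map f), Multiset.map_map]
  rfl

theorem sum_eq_of_map_val_eq {ι κ : Type*} {s : Finset ι} {s' : Finset κ} {f : ι → ℕ}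
    {f' : κ → ℕ} (h : s.val.map f = s'.val.map f') (F : ℕ → ℕ) :
    ∑ k ∈ s, F (f k) = ∑ k ∈ s', F (f' k) := by
  have := congrArg (fun m => (m.map F).sum) h
  simp only [Multiset.map_map] at this
  exact this

theorem sum_Icc_eq_add_pair {M : Type*} [AddCommMonoid M] {i j ℓ : ℕ} (hi : 2 ≤ i) (hij : i < j)
    (hj : j ≤ ℓ) (F : ℕ → M) : ∑ k ∈ Finset.Icc 1 ℓ, F k =
      F i + (F j + ∑ k ∈ ((Finset.Icc 1 ℓ).erase i).erase j, F k) := by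
  rw [← Finset.add_sum_erase _ _ (Finset.mem_Icc.2 ⟨by omega, by omega⟩ : i ∈ Finset.Icc 1 ℓ),
    ← Finset.add_sum_erase ((Finset.Icc 1 ℓ).erase i) _ (Finset.mem_erase.2
      ⟨by omega, Finset.mem_Icc.2 ⟨by omega, by omega⟩⟩ : j ∈ (Finset.Icc 1 ℓ).erase i)]

theorem sum_Icc_ite {M : Type*} [AddCommMonoid M] {i j ℓ : ℕ} (hi : 2 ≤ i) (hij : i < j)
    (hj : j ≤ ℓ) (d : ℕ → ℕ) (F : ℕ → M) :
    ∑ k ∈ Finset.Icc 1 ℓ, F (if k = i ∨ k = j then d k + 1 else d k) =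
      F (d i + 1) + (F (d j + 1) + ∑ k ∈ ((Finset.Icc 1 ℓ).erase i).erase j, F (d k)) := by
  rw [sum_Icc_eq_add_pair hi hij hj, if_pos (Or.inl rfl), if_pos (Or.inr rfl)]
  congr 2
  refine Finset.sum_congr rfl fun k hk => ?_
  rw [Finset.mem_erase, Finset.mem_erase] at hk
  rw [if_neg (by tauto)]

end Arr

/-- Here `A' = A ∖ {H}` is free with exponents `1 = d 1 ≤ d 2 ≤ … ≤ d ℓ`, and
`D = d i + d j + |A^H| - |A'|`. The condition `D ≤ d (j + 1)` is empty for `j = ℓ`. -/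
theorem theorem1p5 {K : Type*} [Field K] (ℓ : ℕ)
    (A : Finset (Submodule K (Fin ℓ → K))) (hA : Arr.IsArrangement A)
    (H : Submodule K (Fin ℓ → K)) (hH : H ∈ A)
    (d : ℕ → ℕ) (hd1 : d 1 = 1) (hmono : MonotoneOn d (Set.Icc 1 ℓ))
    (hfree : Arr.IsFreeWithExp (Arr.deletion A H) ((Finset.Icc 1 ℓ).val.map d))
    (i j : ℕ) (hi : 2 ≤ i) (hij : i < j) (hj : j ≤ ℓ)
    (D : ℕ) (hD : (D : ℤ) = d i + d j + (Arr.restriction A H).card - (Arr.deletion A H).card)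
    (hlow : d j < D) (hup : j < ℓ → D ≤ d (j + 1)) :
    Arr.IsFreeWithExp (Arr.restriction A H)
        ((((Finset.Icc 1 ℓ).erase i).erase j).val.map d + {D}) ↔
      Arr.IsSPOG A
        ((Finset.Icc 1 ℓ).val.map (fun k => if k = i ∨ k = j then d k + 1 else d k)) D := by
  obtain ⟨a, ha0, ha⟩ := hA H hH
  obtain ⟨e, b, he, hb⟩ := hfree
  have hdij : d i ≤ d j := hmono ⟨by omega, by omega⟩ ⟨by omega, hj⟩ hij.le
  have hgap : ∀ k, e k < D → e k ≤ d j := by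
    intro k hk
    have hmem : e k ∈ (Finset.Icc 1 ℓ).val.map d :=
      he ▸ Multiset.mem_map_of_mem e (Finset.mem_univ k)
    obtain ⟨m, hm, hmk⟩ := Multiset.mem_map.1 hmem
    rw [Finset.mem_val, Finset.mem_Icc] at hm
    obtain ⟨hm1, hmℓ⟩ := hm
    rw [← hmk] at hk ⊢
    rcases le_or_gt m j with hmj | hmj
    · exact hmono ⟨hm1, hmℓ⟩ ⟨by omega, hj⟩ hmj
    · have h1 := hup (by omega)
      have h2 := hmono (a := j + 1) (b := m) ⟨by omega, by omega⟩ ⟨hm1, hmℓ⟩ hmj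
      omega
  -- both conditions are equivalent to this one on the Hilbert function of the syzygies on `H`
  have hgens := fun (hdim : ∀ t,
      Module.finrank K (Arr.syzPart H a (fun k => (b k : Arr.Der K (Fin ℓ → K))) e t) +
        Arr.hilb K H (d i) t + Arr.hilb K H (d j) t =
      ∑ k, Arr.hilb K H (e k) t + Arr.hilb K H D t) => Arr.exists_two_generators e
    (fun k => Arr.res H ((b k : Arr.Der K (Fin ℓ → K)) (Arr.form a)))
    (fun k => Arr.map_mem_homogPart (Arr.res_form_mem H) (hb k a)) hdij hlow hgap hdim
  have hcancel : ∀ i₀ j₀ : Fin (Module.finrank K (Fin ℓ → K)), i₀ ≠ j₀ → e i₀ = d i →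
      e j₀ = d j → ∑ l : {k // k ≠ i₀ ∧ k ≠ j₀}, ({e l} : Multiset ℕ) =
        ∑ k ∈ ((Finset.Icc 1 ℓ).erase i).erase j, {d k} := by
    intro i₀ j₀ hij₀ hei hej
    have h1 := he
    rw [Arr.map_val_eq_sum_singleton, Arr.map_val_eq_sum_singleton, Arr.sum_eq_add_pair hij₀,
      Arr.sum_Icc_eq_add_pair hi hij hj, hei, hej] at h1
    exact add_left_cancel (add_left_cancel h1)
  have hsum : ∀ F : ℕ → ℕ, ∑ k, F (e k) =
      F (d i) + (F (d j) + ∑ k ∈ ((Finset.Icc 1 ℓ).erase i).erase j, F (d k)) := fun F => by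
    rw [Arr.sum_eq_of_map_val_eq he F, Arr.sum_Icc_eq_add_pair hi hij hj]
  constructor
  · rintro ⟨E, b', hE, hb'⟩
    obtain ⟨i₀, j₀, u, v, hij₀, hei, hej, hi0, hu0, hv0, hu, hv, huv, huvf, P, Q, hPQ⟩ :=
      hgens fun t => by
        have h1 := Arr.finrank_syzPart_of_free hA ha0 ha b hb b' hb' t
        have h2 : ∑ k, Arr.hilb K H (E k) t =
            ∑ k ∈ ((Finset.Icc 1 ℓ).erase i).erase j, Arr.hilb K H (d k) t + Arr.hilb K H D t := by
          have := congrArg (fun m => (m.map fun s => Arr.hilb K H s t).sum) hE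
          simp only [Multiset.map_map, Multiset.map_add, Multiset.sum_add, Multiset.map_singleton,
            Multiset.sum_singleton] at this
          exact this
        have h3 := hsum fun s => Arr.hilb K H s t
        omega
    rw [← hej] at hu
    rw [← hei] at hv
    refine ⟨Multiset.mem_map.2 ⟨1, by rw [Finset.mem_val, Finset.mem_Icc]; omega, ?_⟩,
      fun k => if k = i₀ ∨ k = j₀ then e k + 1 else e k, ?_,
      Arr.hasMinFreeRes_of_generators hH ha0 ha b hb hij₀ (by omega) (by omega) hi0 hu0 hv0 hu hv
        huv huvf (fun k => hei ▸ (hPQ k).1) (fun k => hej ▸ (hPQ k).2.1) fun k => (hPQ k).2.2⟩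
    · rw [if_neg (by omega), hd1]
    · rw [Arr.map_val_eq_sum_singleton, Arr.map_val_eq_sum_singleton, Arr.sum_eq_add_pair hij₀,
        Arr.sum_Icc_ite hi hij hj d (fun s => ({s} : Multiset ℕ)), if_pos (Or.inl rfl),
        if_pos (Or.inr rfl), hei, hej, ← hcancel i₀ j₀ hij₀ hei hej]
      congr 2
      exact Finset.sum_congr rfl fun l _ => by
        rw [if_neg (by have := l.2; tauto)]
  · rintro ⟨-, e', he', g, r, hg, hr, -, hspan, hli, hker⟩
    obtain ⟨i₀, j₀, u, v, hij₀, hei, hej, hi0, hu0, hv0, hu, hv, huv, huvf, P, Q, hPQ⟩ :=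
      hgens fun t => by
        have h1 := Arr.finrank_syzPart_add hH ha0 ha b e t
        have h2 := Arr.finrank_map_combo_of_res (g := g) (hr ()) (hli.ne_zero ()) (fun c => by
          rw [hker, show r = fun _ => r () from rfl, Set.range_const,
            Submodule.mem_span_singleton]) t
        have h3 : (Arr.homogTuple K (Fin ℓ → K) e t ⊓ ((Arr.logDer A).restrictScalars K).comap
            (Arr.combo K fun k => (b k : Arr.Der K (Fin ℓ → K)))).map
            (Arr.combo K fun k => (b k : Arr.Der K (Fin ℓ → K))) =
            (Arr.homogTuple K (Fin ℓ → K) (Sum.elim e' fun _ : Unit => D) t).map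
              (Arr.combo K g) := by
          ext η
          constructor
          · rintro ⟨c, ⟨hc, hcA⟩, rfl⟩
            have hcA' : Arr.combo K (fun k => (b k : Arr.Der K (Fin ℓ → K))) c ∈
                Submodule.span _ (Set.range g) := hspan ▸ hcA
            obtain ⟨z, hz⟩ := (Submodule.mem_span_range_iff_exists_fun _).1 hcA'
            have hhom := Arr.isHomogDer_combo hb hc
            rw [← hz] at hhom ⊢
            exact ⟨_, Arr.mem_homogTuple.2 fun k => Arr.shiftComponent_mem _ _ _,
              Arr.combo_shiftComponent hg hhom⟩
          · rintro ⟨z, hz, rfl⟩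
            have hzA : Arr.combo K g z ∈ Arr.logDer A :=
              Arr.combo_mem (fun k => hspan ▸ Submodule.subset_span ⟨k, rfl⟩) z
            obtain ⟨c, hc⟩ := Arr.exists_combo_basis_eq b
              ((Arr.mem_logDer_iff_deletion hH ha).1 hzA).1
            have hhom := Arr.isHomogDer_combo hg hz
            rw [← hc] at hhom hzA ⊢
            refine ⟨c, ⟨?_, hzA⟩, rfl⟩
            rw [← Arr.combo_basis_injective b (Arr.combo_shiftComponent hb hhom)]
            exact Arr.mem_homogTuple.2 fun k => Arr.shiftComponent_mem _ _ _
        rw [← h3, Arr.finrank_map_of_injective (Arr.combo_basis_injective b), ← h1,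
          Fintype.sum_sum_type] at h2
        simp only [Sum.elim_inl, Sum.elim_inr, Finset.univ_unique, Finset.sum_singleton] at h2
        have h4 := Arr.sum_eq_of_map_val_eq he' fun s => Arr.hilb K (Fin ℓ → K) s t
        rw [Arr.sum_Icc_ite hi hij hj d (fun s => Arr.hilb K (Fin ℓ → K) s t)] at h4
        have h5 := hsum fun s => Arr.hilb K (Fin ℓ → K) (s + 1) t
        have h6 := hsum fun s => Arr.hilb K H s t
        have h7 := Arr.hilb_eq_add ha0 ha D t
        have h8 : ∑ k ∈ ((Finset.Icc 1 ℓ).erase i).erase j, Arr.hilb K (Fin ℓ → K) (d k) t =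
            ∑ k ∈ ((Finset.Icc 1 ℓ).erase i).erase j, Arr.hilb K (Fin ℓ → K) (d k + 1) t +
            ∑ k ∈ ((Finset.Icc 1 ℓ).erase i).erase j, Arr.hilb K H (d k) t := by
          rw [← Finset.sum_add_distrib]
          exact Finset.sum_congr rfl fun k _ => Arr.hilb_eq_add ha0 ha _ t
        omega
    rw [← hej] at hu
    rw [← hei] at hv
    obtain ⟨b', hb'⟩ := Arr.exists_basis_restriction hA ha0 ha b hb hij₀ hi0 hu0 hv0 hu hv
      huv huvf (fun k => hei ▸ (hPQ k).1) (fun k => hej ▸ (hPQ k).2.1) fun k => (hPQ k).2.2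
    have hcard : Fintype.card (Option {k // k ≠ i₀ ∧ k ≠ j₀}) = Module.finrank K H := by
      have h1 := Arr.sum_eq_add_pair hij₀ (fun _ => 1)
      rw [Finset.sum_const, Finset.sum_const, Finset.card_univ, Finset.card_univ, Fintype.card_fin,
        smul_eq_mul, smul_eq_mul] at h1
      have h2 := Module.Dual.finrank_ker_add_one_of_ne_zero ha0
      rw [← ha] at h2
      rw [Fintype.card_option]
      omega
    let ε := Fintype.equivFinOfCardEq hcard
    refine ⟨fun p => (ε.symm p).elim D fun k => e k, b'.reindex ε, ?_, fun p => ?_⟩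
    · rw [Arr.map_val_eq_sum_singleton, Arr.map_val_eq_sum_singleton,
        ← hcancel i₀ j₀ hij₀ hei hej,
        Equiv.sum_comp ε.symm fun l => ({l.elim D fun k => e k} : Multiset ℕ),
        Fintype.sum_option, add_comm]
      rfl
    · rw [Module.Basis.reindex_apply]
      exact hb' _
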